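/- **Setting.** Let $M$ be a smooth manifold of finite dimension. Let $\mathcal B^{(1)}$ be the groupoid of $1$-jets of local diffeomorphisms of $M$: its elements are the linear isomorphisms $\xi:T_xM\to T_yM$, with source $\alpha(\xi)=x$ and target $\beta(\xi)=y$. A *$(1,1)$-jet* over $\xi$ is the first jet $j^1_xb$ of a local section $b$ of $\alpha:\mathcal B^{(1)}\to M$ with $b(x)=\xi$, that is, a pair $(\xi,L)$ with $L=b_{*x}:T_xM\to T_\xi\mathcal B^{(1)}$ linear and $\alpha_*L=\mathrm{id}$; it is *semi-holonomic* if $\beta_*L=\xi$. It acts on the fibre over $x$ of $T(TM)\to M$ by the differential of $Y\mapsto b\cdot Y$, $TM\to TM$. Likewise the first jet at $x$ of a local section of $(1,1)$-jets (a *$(1,1,1)$-jet*) acts on the fibre $T^3_xM$ over $x$ of $T(T(TM))\to M$, by the differential of the action of $(1,1)$-jets. A *symmetry jet* is a smooth section $\mathfrak s$, $x\mapsto\mathfrak s(x)$, with $\mathfrak s(x)$ a semi-holonomic $(1,1)$-jet over $-I_x:T_xM\to T_xM$. It induces an affine connection $\nabla=\nabla^{\mathfrak s}$, with torsion $T^{\mathfrak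 s}$ and curvature $R^{\mathfrak s}$: $$\nabla_{X_x}Y=\tfrac12\,\pi\bigl(\mathcal X,\,-\mathfrak s(x)\cdot\mathcal X\bigr),\qquad \mathcal X=Y_{*x}X_x ,$$ where $-$ means the fibrewise multiplication by $-1$ in $T(TM)\to TM$ composed with the differential of the multiplication by $-1$ in $TM\to M$, and where $\pi(\mathcal X_1,\mathcal X_2)\in T_xM$ is the difference of two elements of $T(TM)$ with the same foot in $TM$ and the same image under the differential of $TM\to M$. For each $\xi\in\mathcal B^{(1)}$ there is a unique semi-holonomic $(1,1)$-jet $S(\xi)=j^1_xb=(\xi,L_\xi)$ over $\xi$ that is *affine*, i.e. $\xi(\nabla_{X_x}Y)=\nabla_{\xi X_x}(bY)$ for all $X_x\in T_xM$ and all vector fields $Y$ near $x$. The map $\xi\mapsto S(\xi)$ is smooth. The *affine distribution* on $\mathcal B^{(1)}$ is $\mathcal D^{\mathfrak s}_\xi=L_\xi(T_xM)\subset T_\xi\mathcal B^{(1)}$, and its *integrability locus* $\mathrm{Int}(\mathcal D^{\mathfrak s})$ is the set of $\xi\in\mathcal B^{(1)}$ such that $[A,B]_\xi\in\mathcal D^{\mathfrak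 s}_\xi$ for all smooth vector fields $A,B$ tangent to $\mathcal D^{\mathfrak s}$ on an open neighbourhood of $\xi$. Let $\mathbb S(\xi)=j^1_x(S\circ b)$, where $b$ is a local section with $j^1_xb=S(\xi)$; this is the $(1,1,1)$-jet with value $S(\xi)$ and differential $S_{*\xi}\circ L_\xi$. Let $\kappa$ be the canonical involution of $T(TN)$ with $N=TM$, which exchanges the two projections to $TN$; a $(1,1,1)$-jet $\zeta$ with source $x$ is *$\kappa$-invariant* if $\kappa(\zeta\cdot\kappa(\mathfrak X))=\zeta\cdot\mathfrak X$ for all $\mathfrak X\in T^3_xM$. **Lemma.** Let $\mathfrak s$ be a symmetry jet on $M$. Then: 1. A $1$-jet $\xi\in\mathcal B^{(1)}$ belongs to $\mathrm{Int}(\mathcal D^{\mathfrak s})$ if and only if $\mathbb S(\xi)$ is $\kappa$-invariant. 2. $\mathrm{Int}(\mathcal D^{\mathfrak s})$ is the set of the $1$-jets $\xi:T_xM\to T_yM$ that preserve the torsion and the curvature, i.e. such that for all $u,v,w\in T_xM$ $$T^{\mathfrak s}_y(\xi u,\xi v)=\xi\,T^{\mathfrak s}_x(u,v),\qquad R^{\mathfrak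 s}_y(\xi u,\xi v)\,\xi w=\xi\,R^{\mathfrak s}_x(u,v)w .$$ In particular $\mathrm{Int}(\mathcal D^{\mathfrak s})$ is a subgroupoid of $\mathcal B^{(1)}$: it contains the identities and is closed under composition and inversion. -/

import Mathlib

open Bundle Set
open scoped Manifold ContDiff Topology

noncomputable section
namespace JetGpd

section Pullback
variable {B B' : Type*} (V : B → Type*) (f : B' → B)

instance [∀ x, AddCommGroup (V x)] (x : B') : AddCommGroup ((f *ᵖ V) x) :=
  inferInstanceAs (AddCommGroup (V (f x)))

instance [∀ x, AddCommGroup (V x)] [∀ x, TopologicalSpace (V x)]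
    [∀ x, IsTopologicalAddGroup (V x)] (x : B') : IsTopologicalAddGroup ((f *ᵖ V) x) :=
  inferInstanceAs (IsTopologicalAddGroup (V (f x)))

instance [∀ x, AddCommGroup (V x)] [∀ x, Module ℝ (V x)] [∀ x, TopologicalSpace (V x)]
    [∀ x, ContinuousSMul ℝ (V x)] (x : B') : ContinuousSMul ℝ ((f *ᵖ V) x) :=
  inferInstanceAs (ContinuousSMul ℝ (V (f x)))

end Pullback

section TotalSpace
variable {B F EB HB EN HN N : Type*} {V : B → Type*}
  [NormedAddCommGroup F] [NormedSpace ℝ F]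
  [NormedAddCommGroup EB] [NormedSpace ℝ EB] [TopologicalSpace HB] {IB : ModelWithCorners ℝ EB HB}
  [NormedAddCommGroup EN] [NormedSpace ℝ EN] [TopologicalSpace HN] {IN : ModelWithCorners ℝ EN HN}
  [TopologicalSpace B] [ChartedSpace HB B] [TopologicalSpace N] [ChartedSpace HN N]
  [TopologicalSpace (TotalSpace F V)] [∀ x, TopologicalSpace (V x)] [FiberBundle F V]

lemma hasMFDerivAt_totalSpace {f : N → TotalSpace F V} {x : N}
    {A : TangentSpace IN x →L[ℝ] TangentSpace IB (f x).proj} {C : TangentSpace IN x →L[ℝ] F}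
    (hf : ContinuousAt f x)
    (hA : HasMFDerivAt IN IB (fun y => (f y).proj) x A)
    (hC : HasMFDerivAt IN 𝓘(ℝ, F) (fun y => (trivializationAt F V (f x).proj (f y)).2) x C) :
    HasMFDerivAt IN (IB.prod 𝓘(ℝ, F)) f x (ContinuousLinearMap.prod (A : EN →L[ℝ] EB) (C : EN →L[ℝ] F)) := by
  refine ⟨hf, ?_⟩
  have hA2 := hA.2
  have hC2 := hC.2
  refine (HasFDerivWithinAt.prodMk hA2 hC2).congr_of_eventuallyEq ?_ ?_
  · have h1 : f ⁻¹' (trivializationAt F V (f x).proj).source ∈ 𝓝 x :=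
      hf ((trivializationAt F V (f x).proj).open_source.mem_nhds
        FiberBundle.mem_trivializationAt_proj_source)
    have h2 := (continuousAt_extChartAt_symm (I := IN) x).preimage_mem_nhds
      (by simpa using h1)
    filter_upwards [mem_nhdsWithin_of_mem_nhds h2] with z hz
    simp only [writtenInExtChartAt, FiberBundle.extChartAt, Function.comp]
    simp at hz
    ext
    · simp
      rw [Trivialization.coe_fst']
      exact (Trivialization.mem_source _).1 hz
    · simp
      rfl
  · simp only [writtenInExtChartAt, FiberBundle.extChartAt, Function.comp]
    ext
    · simp
    · simp
      rfl

lemma hasMFDerivAt_proj (p : TotalSpace F V) :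
    HasMFDerivAt (IB.prod 𝓘(ℝ, F)) IB (TotalSpace.proj : TotalSpace F V → B) p
      (ContinuousLinearMap.fst ℝ EB F) := by
  refine ⟨(FiberBundle.continuous_proj F V).continuousAt, ?_⟩
  refine (hasFDerivWithinAt_fst).congr_of_eventuallyEq ?_ ?_
  · filter_upwards [extChartAt_target_mem_nhdsWithin (I := IB.prod 𝓘(ℝ, F)) p] with z hz
    rw [FiberBundle.extChartAt_target] at hz
    simp only [writtenInExtChartAt, FiberBundle.extChartAt, Function.comp]
    simp only [PartialEquiv.coe_trans_symm, Function.comp]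
    obtain ⟨⟨h1, h2⟩, -⟩ := hz
    have : ((trivializationAt F V p.proj).toPartialEquiv.symm
      (((extChartAt IB p.proj).prod (PartialEquiv.refl F)).symm z)).proj
        = (extChartAt IB p.proj).symm z.1 :=
      (trivializationAt F V p.proj).proj_symm_apply' h2
    erw [this]
    exact (extChartAt IB p.proj).right_inv h1
  · simp only [writtenInExtChartAt, FiberBundle.extChartAt, Function.comp]
    simp

end TotalSpace

section Congr
variable {F EN HN N : Type*} [NormedAddCommGroup F] [NormedSpace ℝ F]
  [NormedAddCommGroup EN] [NormedSpace ℝ EN] [TopologicalSpace HN] {IN : ModelWithCorners ℝ EN HN}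
  [TopologicalSpace N] [ChartedSpace HN N]

lemma mvfderiv_congr {f g : N → F} {x : N} (h : f =ᶠ[𝓝 x] g) :
    mvfderiv IN f x = mvfderiv IN g x := by
  ext v
  exact congrArg (fun A : EN →L[ℝ] F => A v) h.mfderiv_eq

end Congr

section Jets

variable (E : Type*) [NormedAddCommGroup E] [NormedSpace ℝ E]
  (M : Type*) [TopologicalSpace M] [ChartedSpace E M] [IsManifold 𝓘(ℝ, E) ∞ M]

instance : ContMDiffVectorBundle ∞ E (TangentSpace 𝓘(ℝ, E) : M → Type _) 𝓘(ℝ, E) :=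
  haveI : IsManifold 𝓘(ℝ, E) (∞ + 1) M := ‹IsManifold 𝓘(ℝ, E) ∞ M›
  inferInstance

/-- The bundle over `M × M` with fibre `T_x M` over `(x, y)`. -/
abbrev SrcT : M × M → Type _ :=
  (ContMDiffMap.fst : C^∞⟮𝓘(ℝ, E).prod 𝓘(ℝ, E), M × M; 𝓘(ℝ, E), M⟯) *ᵖ
    (TangentSpace 𝓘(ℝ, E) : M → Type _)

/-- The bundle over `M × M` with fibre `T_y M` over `(x, y)`. -/
abbrev TgtT : M × M → Type _ :=
  (ContMDiffMap.snd : C^∞⟮𝓘(ℝ, E).prod 𝓘(ℝ, E), M × M; 𝓘(ℝ, E), M⟯) *ᵖ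
    (TangentSpace 𝓘(ℝ, E) : M → Type _)

/-- The manifold of all triples `((x, y), A)` with `A : T_x M → T_y M` linear: the total space of the
vector bundle over `M × M` with fibre `Hom(T_x M, T_y M)`. The first jets of local
diffeomorphisms of `M` form the open subset `invertibleJets` of the invertible `A`. -/
abbrev Jet1 := TotalSpace (E →L[ℝ] E) (fun p : M × M => SrcT E M p →L[ℝ] TgtT E M p)

/-- The model of `Jet1`. A tangent vector of `Jet1` at `ξ = ((x, y), A)` has coordinates
`((dx, dy), dA)` with respect to the charts of `M` at `x` and at `y`. -/
abbrev IJ1 := (𝓘(ℝ, E).prod 𝓘(ℝ, E)).prod 𝓘(ℝ, E →L[ℝ] E)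

instance : IsManifold (IJ1 E) ∞ (Jet1 E M) := inferInstance
instance : IsManifold (IJ1 E) 1 (Jet1 E M) := inferInstance
instance : IsManifold (IJ1 E) (∞ + 1) (Jet1 E M) :=
  inferInstanceAs (IsManifold (IJ1 E) ∞ (Jet1 E M))

/-- The source map `((x, y), A) ↦ x`. -/
abbrev alpha : C^∞⟮IJ1 E, Jet1 E M; 𝓘(ℝ, E), M⟯ :=
  ⟨fun ξ => ξ.1.1, contMDiff_fst.comp (contMDiff_proj _)⟩

/-- The target map `((x, y), A) ↦ y`. -/
abbrev beta : C^∞⟮IJ1 E, Jet1 E M; 𝓘(ℝ, E), M⟯ :=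
  ⟨fun ξ => ξ.1.2, contMDiff_snd.comp (contMDiff_proj _)⟩

/-- The bundle over `Jet1` with fibre `T_x M` over `((x, y), A)`. -/
abbrev AlphaT : Jet1 E M → Type _ := (alpha E M) *ᵖ (TangentSpace 𝓘(ℝ, E) : M → Type _)

section Instances
set_option synthInstance.maxHeartbeats 400000
variable (ξ : Jet1 E M)
instance : FiberBundle ((E × E) × (E →L[ℝ] E)) (TangentSpace (IJ1 E) : Jet1 E M → Type _) :=
  inferInstance
instance : VectorBundle ℝ ((E × E) × (E →L[ℝ] E)) (TangentSpace (IJ1 E) : Jet1 E M → Type _) :=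
  inferInstance
instance : ContMDiffVectorBundle ∞ ((E × E) × (E →L[ℝ] E))
    (TangentSpace (IJ1 E) : Jet1 E M → Type _) (IJ1 E) :=
  inferInstance
instance : AddCommGroup (AlphaT E M ξ) := inferInstance
instance : Module ℝ (AlphaT E M ξ) := inferInstance
instance : TopologicalSpace (AlphaT E M ξ) := inferInstance
instance : AddCommGroup (TangentSpace (IJ1 E) ξ) := inferInstance
instance : Module ℝ (TangentSpace (IJ1 E) ξ) := inferInstance
instance : TopologicalSpace (TangentSpace (IJ1 E) ξ) := inferInstance
instance : IsTopologicalAddGroup (TangentSpace (IJ1 E) ξ) := inferInstance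
instance : ContinuousSMul ℝ (TangentSpace (IJ1 E) ξ) := inferInstance
end Instances

/-- The manifold of all pairs `(ξ, L)` with `ξ : Jet1` and `L : T_x M → T_ξ Jet1` linear, `x` the
source of `ξ`. The first jet at `x` of a local section `b` of the source map, defined near `x` and
with values in `Jet1`, is the pair of its value `b x` and its differential at `x`. -/
abbrev Jet2 := TotalSpace (E →L[ℝ] (E × E) × (E →L[ℝ] E))
  (fun ξ : Jet1 E M => AlphaT E M ξ →L[ℝ] TangentSpace (IJ1 E) ξ)

/-- The model of `Jet2`. -/
abbrev IJ2 := (IJ1 E).prod 𝓘(ℝ, E →L[ℝ] (E × E) × (E →L[ℝ] E))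

set_option synthInstance.maxHeartbeats 400000 in
instance : TopologicalSpace (Jet2 E M) :=
  Bundle.ContinuousLinearMap.topologicalSpaceTotalSpace (RingHom.id ℝ) E (AlphaT E M)
    ((E × E) × (E →L[ℝ] E)) (TangentSpace (IJ1 E))

set_option synthInstance.maxHeartbeats 400000 in
instance : IsManifold (IJ2 E) ∞ (Jet2 E M) := inferInstance

end Jets

variable {E : Type*} [NormedAddCommGroup E] [NormedSpace ℝ E]
  {M : Type*} [TopologicalSpace M] [ChartedSpace E M] [IsManifold 𝓘(ℝ, E) ∞ M]


lemma hasMFDerivAt_alpha (ξ : Jet1 E M) :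
    HasMFDerivAt (IJ1 E) 𝓘(ℝ, E) (alpha E M) ξ
      ((ContinuousLinearMap.fst ℝ E E).comp (ContinuousLinearMap.fst ℝ (E × E) (E →L[ℝ] E))) :=
  (hasMFDerivAt_fst ξ.1).comp ξ (hasMFDerivAt_proj ξ)

lemma hasMFDerivAt_beta (ξ : Jet1 E M) :
    HasMFDerivAt (IJ1 E) 𝓘(ℝ, E) (beta E M) ξ
      ((ContinuousLinearMap.snd ℝ E E).comp (ContinuousLinearMap.fst ℝ (E × E) (E →L[ℝ] E))) :=
  (hasMFDerivAt_snd ξ.1).comp ξ (hasMFDerivAt_proj ξ)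

lemma mfderiv_alpha_apply (ξ : Jet1 E M) (U : TangentSpace (IJ1 E) ξ) :
    mfderiv (IJ1 E) 𝓘(ℝ, E) (alpha E M) ξ U = U.1.1 := by
  rw [(hasMFDerivAt_alpha ξ).mfderiv]; rfl

lemma mfderiv_beta_apply (ξ : Jet1 E M) (U : TangentSpace (IJ1 E) ξ) :
    mfderiv (IJ1 E) 𝓘(ℝ, E) (beta E M) ξ U = U.1.2 := by
  rw [(hasMFDerivAt_beta ξ).mfderiv]; rfl

/-- The fibre over `x` of the second tangent bundle `T(TM) → M`: its elements are `⟨Y, (X, W)⟩`,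
`Y ∈ T_x M` the foot in `TM`, `X` the image under the differential of `TM → M`, and `W` the
derivative of the fibre coordinate (in the chart at `x`). -/
abbrev T2At (x : M) :=
  Σ Y : TangentSpace 𝓘(ℝ, E) x, TangentSpace 𝓘(ℝ, E).tangent (⟨x, Y⟩ : TangentBundle 𝓘(ℝ, E) M)

/-- The fibre over `x` of the third tangent bundle `T(T(TM)) → M`: its elements are
`⟨⟨Y, (X, W)⟩, ((dx, dY), (dX, dW))⟩`. -/
abbrev T3At (x : M) :=
  Σ 𝒳 : T2At (E := E) x, TangentSpace 𝓘(ℝ, E).tangent.tangent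
    (⟨⟨x, 𝒳.1⟩, 𝒳.2⟩ : TangentBundle 𝓘(ℝ, E).tangent (TangentBundle 𝓘(ℝ, E) M))

/-- The matrix of a jet in the charts of `M` at its source and at its target. -/
def lin (ξ : Jet1 E M) : E →L[ℝ] E := ξ.2

/-- The differential of the action `(ξ, Y) ↦ ξ Y` of jets on tangent vectors, at `(ξ, Y)` and in the
direction of a pair `(U, w)` where `U` and `w` have the same image in `T_x M`. In coordinates,
`d(A Y) = A dY + dA Y`, over the vector `dy` at the target. -/
def tangentAct {ξ : Jet1 E M} (U : TangentSpace (IJ1 E) ξ) (Y : TangentSpace 𝓘(ℝ, E) ξ.1.1)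
    (w : TangentSpace 𝓘(ℝ, E).tangent (⟨ξ.1.1, Y⟩ : TangentBundle 𝓘(ℝ, E) M)) :
    TangentSpace 𝓘(ℝ, E).tangent (⟨ξ.1.2, ξ.2 Y⟩ : TangentBundle 𝓘(ℝ, E) M) :=
  (U.1.2, lin ξ w.2 + U.2 Y)

/-- The action on the second tangent bundle of the (1,1)-jet `(ξ, L)`: if `L` is the
differential at `x` of the local section `b`, with `b x = ξ`, it is the restriction to the fibre over
`x` of the differential of the map `TM → TM` that sends a tangent vector `Y` at a point `z` near
`x` to `(b z) Y`. -/
def act11 {ξ : Jet1 E M} (L : TangentSpace 𝓘(ℝ, E) ξ.1.1 →L[ℝ] TangentSpace (IJ1 E) ξ)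
    (𝒳 : T2At (E := E) ξ.1.1) : T2At (E := E) ξ.1.2 :=
  ⟨ξ.2 𝒳.1, tangentAct (L 𝒳.2.1) 𝒳.1 𝒳.2⟩

/-- The action on the third tangent bundle of the (1,1,1)-jet with value `j = (ξ, L)` and
differential `Λ`: the differential of the action `act11` of the pairs `(ξ, L)` on the second tangent
bundle, that is of `(Y; X, W) ↦ (A Y; (L X).dy, A W + (L X).dA Y)`, in the direction
`(Λ Z; Z, dY, dX, dW)`. -/
def act111 {j : Jet2 E M} (Λ : TangentSpace 𝓘(ℝ, E) j.1.1.1 →L[ℝ] TangentSpace (IJ2 E) j)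
    (𝔛 : T3At (E := E) j.1.1.1) : T3At (E := E) j.1.1.2 :=
  let A : E →L[ℝ] E := lin j.1
  let L : E →L[ℝ] (E × E) × (E →L[ℝ] E) := j.2
  let Y : E := 𝔛.1.1
  let X : E := 𝔛.1.2.1
  let W : E := 𝔛.1.2.2
  let Z : E := 𝔛.2.1.1
  let Y' : E := 𝔛.2.1.2
  let X' : E := 𝔛.2.2.1
  let W' : E := 𝔛.2.2.2
  let A' : E →L[ℝ] E := (Λ Z).1.2
  let L' : E →L[ℝ] (E × E) × (E →L[ℝ] E) := (Λ Z).2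
  ⟨act11 j.2 𝔛.1, (tangentAct (ξ := j.1) (Λ Z).1 Y (Z, Y'),
    ((L X').1.2 + (L' X).1.2, A W' + A' W + (L X').2 Y + (L' X).2 Y + (L X).2 Y'))⟩

/-- The canonical involution of `T(TN)`, for `N = TM`, which exchanges the foot in `TN` and
the image under the differential of `TN → N`. It covers the identity of `N`, hence of `M`. -/
def kappa {x : M} (𝔛 : T3At (E := E) x) : T3At (E := E) x :=
  ⟨⟨𝔛.1.1, 𝔛.2.1⟩, (𝔛.1.2, 𝔛.2.2)⟩

/-- The jet `-I_x`. -/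
def negJet (x : M) : Jet1 E M := ⟨(x, x), -ContinuousLinearMap.id ℝ (TangentSpace 𝓘(ℝ, E) x)⟩

variable (E M) in
/-- A symmetry jet: a smooth section `x ↦ (-I_x, L_x)` of the source map into the semi-holonomic
(1,1)-jets, that is, the source map composed with `L_x` is the identity and the target map
composed with `L_x` is the first order part, `-I_x`. -/
structure SymmetryJet where
  jet : ∀ x : M, TangentSpace 𝓘(ℝ, E) x →L[ℝ] TangentSpace (IJ1 E) (negJet (E := E) x)
  smooth : ContMDiff 𝓘(ℝ, E) (IJ2 E) ∞ (fun x => (⟨negJet x, jet x⟩ : Jet2 E M))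
  alpha_jet : ∀ (x : M) (v : TangentSpace 𝓘(ℝ, E) x),
    mfderiv (IJ1 E) 𝓘(ℝ, E) (alpha E M) (negJet x) (jet x v) = v
  beta_jet : ∀ (x : M) (v : TangentSpace 𝓘(ℝ, E) x),
    mfderiv (IJ1 E) 𝓘(ℝ, E) (beta E M) (negJet x) (jet x v) = -v

/-- The composition of the two fibrewise multiplications by `-1` on `T(TM)`: the differential
`(Y; X, W) ↦ (-Y; X, -W)` of the one of `TM`, and that of the fibres of `T(TM) → TM`. -/
def thickNeg {x : M} (𝒳 : T2At (E := E) x) : T2At (E := E) x :=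
  ⟨-𝒳.1, (-𝒳.2.1, 𝒳.2.2)⟩

/-- The difference in `T_x M` of two vectors of `T(TM)` that have the same foot `Y` and the
same image `X` in `T_x M` (only applied to such pairs). -/
def vertDiff {x : M} (𝒳₁ 𝒳₂ : T2At (E := E) x) : TangentSpace 𝓘(ℝ, E) x :=
  (𝒳₁.2.2 - 𝒳₂.2.2 : E)

namespace SymmetryJet
variable (𝔰 : SymmetryJet E M)

/-- The connector of the connection `∇` induced by the symmetry jet: half of the vertical difference
between a vector of `T(TM)` and minus its image under the symmetry jet, so that
`∇_v σ = connector (dσ v)`. -/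
def connector {x : M} (𝒳 : T2At (E := E) x) : TangentSpace 𝓘(ℝ, E) x :=
  (1 / 2 : ℝ) • vertDiff 𝒳 (thickNeg (act11 (ξ := negJet x) (𝔰.jet x) 𝒳))

lemma connector_eq {x : M} (𝒳 : T2At (E := E) x) :
    𝔰.connector 𝒳 = (𝒳.2.2 - (1 / 2 : ℝ) • (𝔰.jet x 𝒳.2.1).2 𝒳.1 : E) := by
  obtain ⟨Y, X, W⟩ := 𝒳
  have : 𝔰.connector ⟨Y, X, W⟩ = ((1 / 2 : ℝ) • ((W : E) - (-(W : E) + (𝔰.jet x X).2 Y)) : E) := by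
    simp only [connector, vertDiff, thickNeg, act11, tangentAct, negJet]
    rfl
  have key : ∀ a b : E, (1 / 2 : ℝ) • (a - (-a + b)) = a - (1 / 2 : ℝ) • b := fun a b => by
    module
  exact this.trans (key _ _)

/-- `(ξ, L)` is an affine (1,1)-jet: it is semi-holonomic and its action on the second tangent
bundle intertwines the connectors, that is, it preserves `∇`. -/
structure IsAffine (ξ : Jet1 E M)
    (L : TangentSpace 𝓘(ℝ, E) ξ.1.1 →L[ℝ] TangentSpace (IJ1 E) ξ) : Prop where
  alpha_eq : ∀ v : TangentSpace 𝓘(ℝ, E) ξ.1.1,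
    mfderiv (IJ1 E) 𝓘(ℝ, E) (alpha E M) ξ (L v) = v
  beta_eq : ∀ v : TangentSpace 𝓘(ℝ, E) ξ.1.1,
    mfderiv (IJ1 E) 𝓘(ℝ, E) (beta E M) ξ (L v) = ξ.2 v
  connector_eq : ∀ 𝒳 : T2At (E := E) ξ.1.1,
    𝔰.connector (act11 L 𝒳) = ξ.2 (𝔰.connector 𝒳)

/-- The second order part of the symmetry jet in the chart at `x`. -/
def coef (x : M) : E →L[ℝ] E →L[ℝ] E :=
  (ContinuousLinearMap.snd ℝ (E × E) (E →L[ℝ] E)).comp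
    (𝔰.jet x : E →L[ℝ] (E × E) × (E →L[ℝ] E))

lemma isAffine_iff (ξ : Jet1 E M)
    (L : TangentSpace 𝓘(ℝ, E) ξ.1.1 →L[ℝ] TangentSpace (IJ1 E) ξ) :
    𝔰.IsAffine ξ L ↔ ∀ v : E, L v = (((v, lin ξ v),
      (1 / 2 : ℝ) • ((𝔰.coef ξ.1.2 (lin ξ v)).comp (lin ξ)
        - (lin ξ).comp (𝔰.coef ξ.1.1 v))) : (E × E) × (E →L[ℝ] E)) := by
  have conn : ∀ (h : ∀ v : E, (L v).1.2 = lin ξ v) (Y X W : E),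
      𝔰.connector (act11 L (⟨Y, (X, W)⟩ : T2At (E := E) ξ.1.1)) =
        ξ.2 (𝔰.connector (⟨Y, (X, W)⟩ : T2At (E := E) ξ.1.1)) ↔
      (L X).2 Y = (1 / 2 : ℝ) • (𝔰.coef ξ.1.2 (lin ξ X) (lin ξ Y)
        - lin ξ (𝔰.coef ξ.1.1 X Y)) := by
    intro h Y X W
    have e1 : 𝔰.connector (act11 L (⟨Y, (X, W)⟩ : T2At (E := E) ξ.1.1)) =
        (lin ξ W + (L X).2 Y - (1 / 2 : ℝ) • (𝔰.coef ξ.1.2 (lin ξ X) (lin ξ Y)) : E) := by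
      rw [connector_eq, ← h X]; rfl
    have e2 : ξ.2 (𝔰.connector (⟨Y, (X, W)⟩ : T2At (E := E) ξ.1.1)) =
        (lin ξ (W - (1 / 2 : ℝ) • 𝔰.coef ξ.1.1 X Y) : E) :=
      congrArg (fun z : E => lin ξ z)
        (𝔰.connector_eq (⟨Y, (X, W)⟩ : T2At (E := E) ξ.1.1))
    rw [e1, e2]
    change (lin ξ W + (L X).2 Y - (1 / 2 : ℝ) • (𝔰.coef ξ.1.2 (lin ξ X) (lin ξ Y)) : E) = _ ↔ _
    rw [map_sub, map_smul]
    have key : ∀ w l a b : E, w + l - (1 / 2 : ℝ) • a = w - (1 / 2 : ℝ) • b ↔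
        l = (1 / 2 : ℝ) • (a - b) := by
      intro w l a b
      rw [← sub_eq_zero, ← sub_eq_zero (a := l)]
      have : w + l - (1 / 2 : ℝ) • a - (w - (1 / 2 : ℝ) • b) = l - (1 / 2 : ℝ) • (a - b) := by
        module
      rw [this]
    exact key _ _ _ _
  constructor
  · intro h v
    have h1 : (L v).1.1 = v := (mfderiv_alpha_apply ξ (L v)).symm.trans (h.alpha_eq v)
    have hb : ∀ v : E, (L v).1.2 = lin ξ v := fun v =>
      (mfderiv_beta_apply ξ (L v)).symm.trans (h.beta_eq v)
    refine Prod.ext (Prod.ext h1 (hb v)) ?_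
    refine ContinuousLinearMap.ext fun Y => ?_
    exact (conn hb Y v 0).1 (h.connector_eq _)
  · intro h
    have hb : ∀ v : E, (L v).1.2 = lin ξ v := fun v => congrArg (fun z => z.1.2) (h v)
    refine ⟨fun v => ?_, fun v => ?_, ?_⟩
    · exact (mfderiv_alpha_apply ξ (L v)).trans (congrArg (fun z => z.1.1) (h v))
    · exact (mfderiv_beta_apply ξ (L v)).trans (hb v)
    · rintro ⟨Y, X, W⟩
      refine (conn hb Y X W).2 ?_
      exact congrArg (fun z : (E × E) × (E →L[ℝ] E) => z.2 Y) (h X)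

theorem existsUnique_isAffine (ξ : Jet1 E M) : ∃! L, 𝔰.IsAffine ξ L := by
  let A := lin ξ
  let L : E →L[ℝ] (E × E) × (E →L[ℝ] E) :=
    ((ContinuousLinearMap.id ℝ E).prod A).prod
      ((1 / 2 : ℝ) • (((ContinuousLinearMap.compL ℝ E E E).flip A).comp
        ((𝔰.coef ξ.1.2).comp A) - (ContinuousLinearMap.compL ℝ E E E A).comp (𝔰.coef ξ.1.1)))
  refine ⟨L, (𝔰.isAffine_iff ξ L).2 fun v => rfl, fun L' hL' => ?_⟩
  refine ContinuousLinearMap.ext fun v => ?_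
  exact (𝔰.isAffine_iff ξ L').1 hL' v

/-- The differential part of the affine (1,1)-jet that extends `ξ`. -/
def affineJet (ξ : Jet1 E M) : TangentSpace 𝓘(ℝ, E) ξ.1.1 →L[ℝ] TangentSpace (IJ1 E) ξ :=
  (𝔰.existsUnique_isAffine ξ).choose

/-- The affine extension `ξ ↦ S(ξ)` of the symmetry jet. -/
def S (ξ : Jet1 E M) : Jet2 E M := ⟨ξ, 𝔰.affineJet ξ⟩

/-- The distribution on the jets: `D_ξ` is the image of the differential part of `S(ξ)`. -/
def distribution (ξ : Jet1 E M) : Submodule ℝ (TangentSpace (IJ1 E) ξ) :=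
  LinearMap.range (𝔰.affineJet ξ).toLinearMap

/-- The differential part of the third order affine extension `𝕊(ξ)`, a (1,1,1)-jet with value `S(ξ)`:
the first jet of `S ∘ b` if `b` is a local section with first jet `S(ξ)`. -/
def S3 (ξ : Jet1 E M) : TangentSpace 𝓘(ℝ, E) ξ.1.1 →L[ℝ] TangentSpace (IJ2 E) (𝔰.S ξ) :=
  (mfderiv (IJ1 E) (IJ2 E) 𝔰.S ξ).comp (𝔰.affineJet ξ)

/-- Invariance under the involution `κ` of (1,1,1)-jets, `κ(ζ) 𝔛 = κ(ζ (κ 𝔛))`. -/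
def IsKappaInvariant {j : Jet2 E M}
    (Λ : TangentSpace 𝓘(ℝ, E) j.1.1.1 →L[ℝ] TangentSpace (IJ2 E) j) : Prop :=
  ∀ 𝔛 : T3At (E := E) j.1.1.1, kappa (act111 Λ (kappa 𝔛)) = act111 Λ 𝔛
end SymmetryJet

/-- A vector field near `x`, written in the preferred trivialization at `x`. -/
def fieldCoord (x : M) (σ : ∀ y : M, TangentSpace 𝓘(ℝ, E) y) : M → E :=
  fun y => (trivializationAt E (TangentSpace 𝓘(ℝ, E) : M → Type _) x (T% σ y)).2

lemma fieldCoord_self (x : M) (σ : ∀ y : M, TangentSpace 𝓘(ℝ, E) y) :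
    fieldCoord x σ x = σ x :=
  (tangentBundleCore 𝓘(ℝ, E) M).coordChange_self (achart E x) x (mem_chart_source E x) (σ x)

lemma mfderiv_section {σ : ∀ y : M, TangentSpace 𝓘(ℝ, E) y} {x : M} (h : MDiffAt (T% σ) x)
    (v : TangentSpace 𝓘(ℝ, E) x) :
    mfderiv 𝓘(ℝ, E) 𝓘(ℝ, E).tangent (T% σ) x v = ((v, d% (fieldCoord x σ) x v) : E × E) := by
  have h2 := ((mdifferentiableAt_section (IB := 𝓘(ℝ, E)) (F := E) σ).1 h).hasMFDerivAt
  have h1 : HasMFDerivAt 𝓘(ℝ, E) 𝓘(ℝ, E) (fun y : M => (T% σ y).proj) x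
      (ContinuousLinearMap.id ℝ (TangentSpace 𝓘(ℝ, E) x)) := hasMFDerivAt_id x
  rw [(hasMFDerivAt_totalSpace h.continuousAt h1 h2).mfderiv]
  rfl

lemma mdifferentiableAt_fieldCoord {σ : ∀ y : M, TangentSpace 𝓘(ℝ, E) y} {x : M}
    (h : MDiffAt (T% σ) x) : MDiffAt (fieldCoord x σ) x :=
  (mdifferentiableAt_section (IB := 𝓘(ℝ, E)) (F := E) σ).1 h

lemma fieldCoord_add (x : M) (σ τ : ∀ y : M, TangentSpace 𝓘(ℝ, E) y) :
    fieldCoord x (σ + τ) =ᶠ[𝓝 x] fieldCoord x σ + fieldCoord x τ := by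
  set e := trivializationAt E (TangentSpace 𝓘(ℝ, E) : M → Type _) x
  filter_upwards [e.open_baseSet.mem_nhds (mem_baseSet_trivializationAt E _ x)] with y hy
  exact (e.linear ℝ hy).1 ..

lemma fieldCoord_smul (x : M) (g : M → ℝ) (σ : ∀ y : M, TangentSpace 𝓘(ℝ, E) y) :
    fieldCoord x (g • σ) =ᶠ[𝓝 x] g • fieldCoord x σ := by
  set e := trivializationAt E (TangentSpace 𝓘(ℝ, E) : M → Type _) x
  filter_upwards [e.open_baseSet.mem_nhds (mem_baseSet_trivializationAt E _ x)] with y hy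
  exact (e.linear ℝ hy).2 ..

namespace SymmetryJet
variable (𝔰 : SymmetryJet E M)

/-- The covariant derivative of the vector field `σ`, at `x`. -/
def nablaAt (σ : ∀ x : M, TangentSpace 𝓘(ℝ, E) x) (x : M) :
    TangentSpace 𝓘(ℝ, E) x →L[ℝ] TangentSpace 𝓘(ℝ, E) x :=
  have key : ∃ A : E →L[ℝ] E, ∀ v : E, 𝔰.connector
      (⟨σ x, mfderiv 𝓘(ℝ, E) 𝓘(ℝ, E).tangent (T% σ) x v⟩ : T2At (E := E) x) = A v := by
    let D : E →L[ℝ] E × E := mfderiv 𝓘(ℝ, E) 𝓘(ℝ, E).tangent (T% σ) x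
    exact ⟨(ContinuousLinearMap.snd ℝ E E).comp D - (1 / 2 : ℝ) •
      ((𝔰.coef x).flip (σ x)).comp ((ContinuousLinearMap.fst ℝ E E).comp D),
      fun v => 𝔰.connector_eq _⟩
  { toFun := fun v => 𝔰.connector ⟨σ x, mfderiv 𝓘(ℝ, E) 𝓘(ℝ, E).tangent (T% σ) x v⟩
    map_add' := fun v w => by
      obtain ⟨A, hA⟩ := key
      exact (hA (v + w)).trans ((A.map_add v w).trans
        (congrArg₂ (fun a b : E => a + b) (hA v) (hA w)).symm)
    map_smul' := fun c v => by
      obtain ⟨A, hA⟩ := key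
      exact (hA (c • v)).trans ((A.map_smul c v).trans
        (congrArg (fun a : E => c • a) (hA v)).symm)
    cont := by
      obtain ⟨A, hA⟩ := key
      exact A.continuous.congr fun v => (hA v).symm }

lemma nablaAt_apply {σ : ∀ y : M, TangentSpace 𝓘(ℝ, E) y} {x : M} (h : MDiffAt (T% σ) x)
    (v : E) : 𝔰.nablaAt σ x v =
      (d% (fieldCoord x σ) x v - (1 / 2 : ℝ) • 𝔰.coef x v (σ x) : E) := by
  refine (𝔰.connector_eq _).trans ?_
  have := mfderiv_section h v
  simp only [this]
  rfl

/-- The affine connection induced by the symmetry jet. -/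
def nabla : CovariantDerivative 𝓘(ℝ, E) E (TangentSpace 𝓘(ℝ, E) : M → Type _) where
  toFun := 𝔰.nablaAt
  isCovariantDerivativeOnUniv :=
    { add := fun {σ τ x} hσ hτ _ => by
        have key : ∀ a b s t : E, a + b - (1 / 2 : ℝ) • (s + t) =
          (a - (1 / 2 : ℝ) • s) + (b - (1 / 2 : ℝ) • t) := fun a b s t => by module
        refine ContinuousLinearMap.ext fun v => ?_
        refine (𝔰.nablaAt_apply (mdifferentiableAt_add_section hσ hτ) v).trans ?_
        rw [mvfderiv_congr (fieldCoord_add x σ τ), mvfderiv_add (mdifferentiableAt_fieldCoord hσ)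
            (mdifferentiableAt_fieldCoord hτ)]
        refine Eq.trans ?_ (congrArg₂ (fun a b : E => a + b) (𝔰.nablaAt_apply hσ v)
          (𝔰.nablaAt_apply hτ v)).symm
        refine Eq.trans ?_ (key _ _ _ _)
        exact congrArg (fun z : E => _ - (1 / 2 : ℝ) • z) ((𝔰.coef x v).map_add (σ x) (τ x))
      leibniz := fun {σ g x} hσ hg _ => by
        have key : ∀ (a b s : E) (c : ℝ), c • a + b - (1 / 2 : ℝ) • (c • s) =
          c • (a - (1 / 2 : ℝ) • s) + b := fun a b s c => by module
        refine ContinuousLinearMap.ext fun v => ?_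
        refine (𝔰.nablaAt_apply (MDifferentiableAt.smul_section hg hσ) v).trans ?_
        rw [mvfderiv_congr (fieldCoord_smul x g σ), mvfderiv_smul hg
          (mdifferentiableAt_fieldCoord hσ), fieldCoord_self]
        let t : E := d% g x v • σ x
        refine Eq.trans ?_ (congrArg (fun a : E => g x • a + t)
          (𝔰.nablaAt_apply hσ v)).symm
        refine Eq.trans ?_ (key _ _ _ _)
        exact congrArg (fun z : E => _ - (1 / 2 : ℝ) • z) ((𝔰.coef x v).map_smul (g x) (σ x)) }

end SymmetryJet

/-- The curvature `R(u, v) w = ∇_U ∇_V W - ∇_V ∇_U W - ∇_[U, V] W` at `x`; the vector fields are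
extensions of `u, v, w` that are smooth near `x`, and the value does not depend on them for a
smooth connection. -/
def curvature (cov : CovariantDerivative 𝓘(ℝ, E) E (TangentSpace 𝓘(ℝ, E) : M → Type _)) (x : M)
    (u v w : TangentSpace 𝓘(ℝ, E) x) : TangentSpace 𝓘(ℝ, E) x :=
  let U : ∀ y : M, TangentSpace 𝓘(ℝ, E) y := FiberBundle.extend E u
  let V : ∀ y : M, TangentSpace 𝓘(ℝ, E) y := FiberBundle.extend E v
  let W : ∀ y : M, TangentSpace 𝓘(ℝ, E) y := FiberBundle.extend E w
  cov (fun y => cov W y (V y)) x (U x) - cov (fun y => cov W y (U y)) x (V x)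
    - cov W x (VectorField.mlieBracket 𝓘(ℝ, E) U V x)

section Distributions
variable {F H W : Type*} [NormedAddCommGroup F] [NormedSpace ℝ F] [TopologicalSpace H]
  (I : ModelWithCorners ℝ F H) [TopologicalSpace W] [ChartedSpace H W] [IsManifold I 1 W]

/-- The integrability locus of a distribution `D` on the open subset `U` of the manifold `W`: the
points `w` at which the bracket of any two smooth local vector fields near `w` that are tangent to
`D` belongs to `D`. -/
def integrabilityLocus (U : Set W) (D : ∀ w : W, Submodule ℝ (TangentSpace I w)) : Set W :=
  {w | w ∈ U ∧ ∀ V : Set W, IsOpen V → w ∈ V → V ⊆ U →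
    ∀ A B : (∀ z : W, TangentSpace I z),
      ContMDiffOn I I.tangent ∞ (fun z => (⟨z, A z⟩ : TangentBundle I W)) V →
      ContMDiffOn I I.tangent ∞ (fun z => (⟨z, B z⟩ : TangentBundle I W)) V →
      (∀ z ∈ V, A z ∈ D z) → (∀ z ∈ V, B z ∈ D z) →
      VectorField.mlieBracket I A B w ∈ D w}
end Distributions

variable (E M) in
/-- The groupoid of first jets of local diffeomorphisms of `M`. -/
def invertibleJets : Set (Jet1 E M) := {ξ | ξ.2.IsInvertible}

variable [FiniteDimensional ℝ E] in
/-- The jets that preserve the torsion and the curvature. -/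
def preserving (𝔰 : SymmetryJet E M) : Set (Jet1 E M) :=
  haveI : CompleteSpace E := FiniteDimensional.complete ℝ E
  haveI : IsManifold 𝓘(ℝ, E) 2 M := IsManifold.of_le (n := ∞) (by norm_cast)
  {ξ | ξ ∈ invertibleJets E M ∧
    (∀ u v : TangentSpace 𝓘(ℝ, E) ξ.1.1,
      𝔰.nabla.torsion ξ.1.2 (ξ.2 u) (ξ.2 v) = ξ.2 (𝔰.nabla.torsion ξ.1.1 u v)) ∧
    ∀ u v w : TangentSpace 𝓘(ℝ, E) ξ.1.1,
      curvature 𝔰.nabla ξ.1.2 (ξ.2 u) (ξ.2 v) (ξ.2 w) = ξ.2 (curvature 𝔰.nabla ξ.1.1 u v w)}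

/-- A set of first jets is a subgroupoid of the groupoid of invertible first jets. -/
structure IsSubgroupoid (s : Set (Jet1 E M)) : Prop where
  subset : s ⊆ invertibleJets E M
  one_mem : ∀ x : M,
    (⟨(x, x), ContinuousLinearMap.id ℝ (TangentSpace 𝓘(ℝ, E) x)⟩ : Jet1 E M) ∈ s
  comp_mem : ∀ (x y z : M) (A : TangentSpace 𝓘(ℝ, E) x →L[ℝ] TangentSpace 𝓘(ℝ, E) y)
    (B : TangentSpace 𝓘(ℝ, E) y →L[ℝ] TangentSpace 𝓘(ℝ, E) z),
    (⟨(x, y), A⟩ : Jet1 E M) ∈ s → (⟨(y, z), B⟩ : Jet1 E M) ∈ s →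
      (⟨(x, z), B.comp A⟩ : Jet1 E M) ∈ s
  inv_mem : ∀ (x y : M) (A : TangentSpace 𝓘(ℝ, E) x ≃L[ℝ] TangentSpace 𝓘(ℝ, E) y),
    (⟨(x, y), (A : TangentSpace 𝓘(ℝ, E) x →L[ℝ] TangentSpace 𝓘(ℝ, E) y)⟩ : Jet1 E M) ∈ s →
      (⟨(y, x), (A.symm : TangentSpace 𝓘(ℝ, E) y →L[ℝ] TangentSpace 𝓘(ℝ, E) x)⟩ : Jet1 E M) ∈ s

end JetGpd

end

/-! Work in the charts at the source and the target of `ξ`, with Christoffel symbols Γ at the source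
and Γ' at the target. If a jet `η` near `ξ` has matrix A, the differential of its affine extension
is F(η) v = (v, A v, A Γ(v, ·) − Γ'(A v, A ·)) (`jetCoord₂_S`), so the affine distribution is the
image of F(η), a graph over the directions of the source.

A field tangent to the distribution is η ↦ F(η) a(η), where a is its source component. Put B(u, v) =
dF_ξ(F(ξ) u) v. By the product rule, the bracket of two such fields with values F(ξ) a and F(ξ) b at
`ξ` is B(a, b) − B(b, a) modulo the distribution. This difference has no source component, so it
lies in the graph only if it vanishes. Hence `ξ` is in the integrability locus exactly when B is
symmetric (`IsSymmAt`, `mem_integrabilityLocus_iff`).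

The differential of the (1,1,1)-jet over `ξ` is u ↦ (F(ξ) u, B(u, ·)). In its action on the third
tangent bundle, κ permutes all the terms except B(Z, X), which becomes B(X, Z); κ-invariance is
therefore the same symmetry (`isKappaInvariant_iff`).

Finally, the first order part of B(u, v) is A Γ(u, v) − Γ'(A u, A v), whose symmetry says that A
preserves the torsion. Given this, the antisymmetrization of the second order part is A R − R'(A, A)
A (`isSymmAt_iff`). Preserving two tensors is stable under composition and inversion, whence the
subgroupoid. -/

noncomputable section
namespace JetGpd

/-! ### Calculus in the preferred chart at a point, and the Lie bracket in coordinates. -/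

section ChartDerivative

variable {EN HN N F F' : Type*} [NormedAddCommGroup EN] [NormedSpace ℝ EN] [TopologicalSpace HN]
  {I : ModelWithCorners ℝ EN HN} [TopologicalSpace N] [ChartedSpace HN N]
  [NormedAddCommGroup F] [NormedSpace ℝ F] [NormedAddCommGroup F'] [NormedSpace ℝ F']

variable (I) in
/-- The vector valued function `f` has the derivative `A` at `x`, in the chart at `x`. -/
def HasChartDeriv (f : N → F) (x : N) (A : EN →L[ℝ] F) : Prop :=
  HasFDerivAt (f ∘ (extChartAt I x).symm) A (extChartAt I x x)

namespace HasChartDeriv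

lemma congr {f g : N → F} {x : N} {A : EN →L[ℝ] F} (hf : HasChartDeriv I f x A)
    (h : f =ᶠ[𝓝 x] g) : HasChartDeriv I g x A := by
  refine HasFDerivAt.congr_of_eventuallyEq hf ?_
  have h1 : Filter.Tendsto (extChartAt I x).symm (𝓝 (extChartAt I x x)) (𝓝 x) := by
    simpa using (continuousAt_extChartAt_symm (I := I) x).tendsto
  exact (h1.eventually h).mono fun z hz => hz.symm

lemma continuousAt {f : N → F} {x : N} {A : EN →L[ℝ] F} (hf : HasChartDeriv I f x A) :
    ContinuousAt f x := by
  have h1 : ContinuousAt ((f ∘ (extChartAt I x).symm) ∘ extChartAt I x) x :=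
    ContinuousAt.comp (HasFDerivAt.continuousAt hf) (continuousAt_extChartAt x)
  refine h1.congr ?_
  filter_upwards [extChartAt_source_mem_nhds (I := I) x] with z hz
  exact congrArg f ((extChartAt I x).left_inv hz)

lemma hasMFDerivAt {f : N → F} {x : N} {A : EN →L[ℝ] F} (hf : HasChartDeriv I f x A) :
    HasMFDerivAt I 𝓘(ℝ, F) f x A :=
  ⟨hf.continuousAt, HasFDerivAt.hasFDerivWithinAt hf⟩

lemma of_hasMFDerivAt [I.Boundaryless] {f : N → F} {x : N} {A : EN →L[ℝ] F}
    (hf : HasMFDerivAt I 𝓘(ℝ, F) f x A) : HasChartDeriv I f x A := by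
  have := hf.2
  rw [I.range_eq_univ] at this
  exact hasFDerivWithinAt_univ.1 this

lemma of_mdifferentiableAt [I.Boundaryless] {f : N → F} {x : N}
    (hf : MDifferentiableAt I 𝓘(ℝ, F) f x) : ∃ A, HasChartDeriv I f x A :=
  ⟨_, of_hasMFDerivAt hf.hasMFDerivAt⟩

lemma unique {f : N → F} {x : N} {A B : EN →L[ℝ] F} (hA : HasChartDeriv I f x A)
    (hB : HasChartDeriv I f x B) : A = B :=
  HasFDerivAt.unique hA hB

lemma comp {g : F → F'} {f : N → F} {x : N} {A : EN →L[ℝ] F} {B : F →L[ℝ] F'}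
    (hg : HasFDerivAt g B (f x)) (hf : HasChartDeriv I f x A) :
    HasChartDeriv I (fun z => g (f z)) x (B.comp A) := by
  refine HasFDerivAt.comp (g := g) (extChartAt I x x) ?_ hf
  simpa using hg

lemma const (c : F) (x : N) : HasChartDeriv I (fun _ : N => c) x 0 :=
  hasFDerivAt_const c _

lemma clm_apply {f : N → F →L[ℝ] F'} {g : N → F} {x : N} {A : EN →L[ℝ] F →L[ℝ] F'}
    {B : EN →L[ℝ] F} (hf : HasChartDeriv I f x A) (hg : HasChartDeriv I g x B) :
    HasChartDeriv I (fun z => f z (g z)) x ((f x).comp B + A.flip (g x)) := by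
  have := HasFDerivAt.clm_apply hf hg
  simp only [Function.comp, extChartAt_to_inv] at this
  exact this

lemma clm_comp {F'' : Type*} [NormedAddCommGroup F''] [NormedSpace ℝ F'']
    {f : N → F' →L[ℝ] F''} {g : N → F →L[ℝ] F'} {x : N} {A : EN →L[ℝ] F' →L[ℝ] F''}
    {B : EN →L[ℝ] F →L[ℝ] F'} (hf : HasChartDeriv I f x A) (hg : HasChartDeriv I g x B) :
    HasChartDeriv I (fun z => (f z).comp (g z)) x
      ((ContinuousLinearMap.compL ℝ F F' F'' (f x)).comp B +
        ((ContinuousLinearMap.compL ℝ F F' F'').flip (g x)).comp A) := by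
  have := HasFDerivAt.clm_comp hf hg
  simp only [Function.comp, extChartAt_to_inv] at this
  exact this

lemma prodMk {f : N → F} {g : N → F'} {x : N} {A : EN →L[ℝ] F} {B : EN →L[ℝ] F'}
    (hf : HasChartDeriv I f x A) (hg : HasChartDeriv I g x B) :
    HasChartDeriv I (fun z => (f z, g z)) x (A.prod B) :=
  HasFDerivAt.prodMk hf hg

lemma sub {f g : N → F} {x : N} {A B : EN →L[ℝ] F}
    (hf : HasChartDeriv I f x A) (hg : HasChartDeriv I g x B) :
    HasChartDeriv I (fun z => f z - g z) x (A - B) :=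
  HasFDerivAt.sub hf hg

lemma comp_hasMFDerivAt {EN' HN' N' : Type*} [NormedAddCommGroup EN'] [NormedSpace ℝ EN']
    [TopologicalSpace HN'] {I' : ModelWithCorners ℝ EN' HN'} [TopologicalSpace N']
    [ChartedSpace HN' N'] [I.Boundaryless] {f : N' → F} {g : N → N'} {x : N} {A : EN' →L[ℝ] F}
    {B : EN →L[ℝ] EN'} (hf : HasChartDeriv I' f (g x) A) (hg : HasMFDerivAt I I' g x B) :
    HasChartDeriv I (fun z => f (g z)) x (A.comp B) :=
  of_hasMFDerivAt (hf.hasMFDerivAt.comp x hg)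

end HasChartDeriv

variable [I.Boundaryless]

/-- The bracket of two vector fields in terms of their coordinates. -/
lemma mlieBracket_eq_of_hasChartDeriv [IsManifold I 1 N] {x : N} {V W : ∀ y : N, TangentSpace I y}
    {A B : EN →L[ℝ] EN}
    (hV : HasChartDeriv I
      (fun z => (trivializationAt EN (TangentSpace I : N → Type _) x ⟨z, V z⟩).2) x A)
    (hW : HasChartDeriv I
      (fun z => (trivializationAt EN (TangentSpace I : N → Type _) x ⟨z, W z⟩).2) x B) :
    VectorField.mlieBracket I V W x = (B (V x) - A (W x) : EN) := by
  -- The trivialization at `x` is the differential of the chart at `x`, so the pullback of a field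
  -- by the inverse chart is its coordinate function.
  have key : ∀ U : ∀ y : N, TangentSpace I y,
      VectorField.mpullbackWithin 𝓘(ℝ, EN) I (extChartAt I x).symm U (range I)
        =ᶠ[𝓝 (extChartAt I x x)]
      (fun z => (trivializationAt EN (TangentSpace I : N → Type _) x ⟨z, U z⟩).2) ∘
        (extChartAt I x).symm := by
    intro U
    filter_upwards [extChartAt_target_mem_nhds (I := I) x] with z hz
    have h1 : (extChartAt I x).symm z ∈ (chartAt HN x).source := by
      simpa using (extChartAt I x).map_target hz
    rw [VectorField.mpullbackWithin_apply]
    have e1 := TangentBundle.symmL_trivializationAt (I := I) h1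
    rw [(extChartAt I x).right_inv hz] at e1
    rw [← e1]
    have e2 := TangentBundle.continuousLinearMapAt_trivializationAt (I := I) h1
    have h2 : (extChartAt I x).symm z ∈
      (trivializationAt EN (TangentSpace I : N → Type _) x).baseSet := h1
    refine (congrArg (fun A : TangentSpace I ((extChartAt I x).symm z) →L[ℝ] EN => A (U _))
      (ContinuousLinearMap.inverse_eq
      (g := (trivializationAt EN (TangentSpace I : N → Type _) x).continuousLinearMapAt ℝ
        ((extChartAt I x).symm z)) ?_ ?_)).trans ?_
    · exact ContinuousLinearMap.ext fun v => Trivialization.symmL_continuousLinearMapAt _ h2 v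
    · exact ContinuousLinearMap.ext fun v => Trivialization.continuousLinearMapAt_symmL _ h2 v
    · simp only [Function.comp]
      exact Trivialization.continuousLinearMapAt_apply_of_mem ℝ _ h2 _
  have h3 : ∀ U : ∀ y : N, TangentSpace I y,
    (trivializationAt EN (TangentSpace I : N → Type _) x ⟨x, U x⟩).2 = U x := fun U =>
    (tangentBundleCore I N).coordChange_self (achart HN x) x (mem_chart_source HN x) (U x)
  rw [← VectorField.mlieBracketWithin_univ, VectorField.mlieBracketWithin_apply,
    mfderiv_extChartAt_self, I.range_eq_univ, preimage_univ, univ_inter]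
  rw [I.range_eq_univ] at key
  have h4 := (congrFun (VectorField.lieBracketWithin_univ (𝕜 := ℝ)) _).trans
    ((key V).lieBracket_vectorField_eq (𝕜 := ℝ) (key W))
  refine (congrArg (fun A : EN →L[ℝ] EN => A _) ContinuousLinearMap.inverse_id).trans ?_
  refine h4.trans ?_
  rw [VectorField.lieBracket, HasFDerivAt.fderiv hV, HasFDerivAt.fderiv hW]
  -- The base point is generalized to `y` because the type of `U y` depends on it, which prevents
  -- rewriting in place.
  have h5 : ∀ (U : ∀ y : N, TangentSpace I y) (y : N), y = x →
      (trivializationAt EN (TangentSpace I : N → Type _) x ⟨y, U y⟩).2 = U x := by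
    rintro U _ rfl
    exact h3 U
  simp only [Function.comp]
  rw [h5 V _ (extChartAt_to_inv x), h5 W _ (extChartAt_to_inv x)]

end ChartDerivative

/-! ### Charts and tangent vectors of the total space of a fibre bundle. -/

section TotalSpace
variable {B F EB HB : Type*} {V : B → Type*}
  [NormedAddCommGroup F] [NormedSpace ℝ F]
  [NormedAddCommGroup EB] [NormedSpace ℝ EB] [TopologicalSpace HB] {IB : ModelWithCorners ℝ EB HB}
  [TopologicalSpace B] [ChartedSpace HB B]
  [TopologicalSpace (TotalSpace F V)] [∀ x, TopologicalSpace (V x)] [FiberBundle F V]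

/-- The derivative of the fibre coordinate of a bundle. -/
lemma hasChartDeriv_fiberCoord [IB.Boundaryless] (p : TotalSpace F V) :
    HasChartDeriv (IB.prod 𝓘(ℝ, F)) (fun q => (trivializationAt F V p.proj q).2) p
      (ContinuousLinearMap.snd ℝ EB F) := by
  refine HasFDerivAt.congr_of_eventuallyEq hasFDerivAt_snd ?_
  filter_upwards [extChartAt_target_mem_nhds (I := IB.prod 𝓘(ℝ, F)) p] with z hz
  rw [FiberBundle.extChartAt_target] at hz
  simp only [FiberBundle.extChartAt, Function.comp]
  simp only [PartialEquiv.coe_trans_symm, Function.comp]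
  obtain ⟨⟨h1, h2⟩, -⟩ := hz
  exact congrArg Prod.snd ((trivializationAt F V p.proj).apply_symm_apply' h2)

lemma mem_chart_source_totalSpace {p q : TotalSpace F V}
    (hq : q.proj ∈ (chartAt HB p.proj).source)
    (hq' : q.proj ∈ (trivializationAt F V p.proj).baseSet) :
    q ∈ (chartAt (ModelProd HB F) p).source := by
  rw [FiberBundle.chartedSpace_chartAt]
  refine ⟨(trivializationAt F V p.proj).mem_source.2 hq', ?_, mem_univ _⟩
  change (trivializationAt F V p.proj q).1 ∈ _
  rwa [Trivialization.coe_fst' _ hq']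

/-- The coordinates of a tangent vector of the total space of a bundle. -/
lemma trivializationAt_tangent_totalSpace [IB.Boundaryless]
    [IsManifold (IB.prod 𝓘(ℝ, F)) 1 (TotalSpace F V)] {p q : TotalSpace F V}
    (hq : q.proj ∈ (chartAt HB p.proj).source)
    (hq' : q.proj ∈ (trivializationAt F V p.proj).baseSet)
    {A : EB × F →L[ℝ] EB} {C : EB × F →L[ℝ] F}
    (hA : HasChartDeriv (IB.prod 𝓘(ℝ, F)) (fun r => extChartAt IB p.proj r.proj) q A)
    (hC : HasChartDeriv (IB.prod 𝓘(ℝ, F)) (fun r => (trivializationAt F V p.proj r).2) q C)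
    (U : EB × F) :
    (trivializationAt (EB × F) (TangentSpace (IB.prod 𝓘(ℝ, F)) : TotalSpace F V → Type _) p
      ⟨q, U⟩).2 = (A U, C U) := by
  have h1 := mem_chart_source_totalSpace hq hq'
  -- The chart of the total space at `p` is the pair of the base chart and the fibre coordinate, and
  -- its differential is the trivialization of the tangent bundle.
  have h2 : HasChartDeriv (IB.prod 𝓘(ℝ, F)) (extChartAt (IB.prod 𝓘(ℝ, F)) p) q (A.prod C) := by
    refine (hA.prodMk hC).congr ?_
    have : (trivializationAt F V p.proj).source ∈ 𝓝 q :=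
      (trivializationAt F V p.proj).open_source.mem_nhds
        ((trivializationAt F V p.proj).mem_source.2 hq')
    filter_upwards [this] with r hr
    simp only [FiberBundle.extChartAt]
    ext
    · simp
      rw [Trivialization.coe_fst']
      exact (Trivialization.mem_source _).1 hr
    · simp
  have h3 := TangentBundle.continuousLinearMapAt_trivializationAt (I := IB.prod 𝓘(ℝ, F)) h1
  rw [h2.hasMFDerivAt.mfderiv] at h3
  refine Eq.trans ?_ (congrArg (fun A : EB × F →L[ℝ] EB × F => A U) h3)
  exact (Trivialization.continuousLinearMapAt_apply_of_mem ℝ _ h1 _).symm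

end TotalSpace

/-! ### Transition maps of `M`, and coordinates on `Jet1` and `Jet2` in fixed charts. -/

section Transition

variable {E : Type*} [NormedAddCommGroup E] [NormedSpace ℝ E]
  {M : Type*} [TopologicalSpace M] [ChartedSpace E M] [IsManifold 𝓘(ℝ, E) ∞ M]

/-- The derivative of the transition map from the chart at `a` to the chart at `b`, at `z`. -/
def trans (a b z : M) : E →L[ℝ] E := tangentCoordChange 𝓘(ℝ, E) a b z

lemma trans_self {a z : M} (h : z ∈ (chartAt E a).source) :
    trans a a z = ContinuousLinearMap.id ℝ E :=
  ContinuousLinearMap.ext fun v => tangentCoordChange_self (I := 𝓘(ℝ, E)) (by simpa using h)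

lemma trans_trans {a b c z : M} (ha : z ∈ (chartAt E a).source) (hb : z ∈ (chartAt E b).source)
    (hc : z ∈ (chartAt E c).source) (v : E) : trans b c z (trans a b z v) = trans a c z v :=
  tangentCoordChange_comp (I := 𝓘(ℝ, E)) (by simpa using ⟨⟨ha, hb⟩, hc⟩)

lemma trans_trans_cancel {a b z : M} (ha : z ∈ (chartAt E a).source)
    (hb : z ∈ (chartAt E b).source) (v : E) : trans b a z (trans a b z v) = v := by
  rw [trans_trans ha hb ha, trans_self ha]; rfl

lemma contMDiffOn_trans (a b : M) : ContMDiffOn 𝓘(ℝ, E) 𝓘(ℝ, E →L[ℝ] E) ∞ (trans (E := E) a b)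
    ((chartAt E a).source ∩ (chartAt E b).source) := by
  have : IsManifold 𝓘(ℝ, E) (∞ + 1) M := ‹IsManifold 𝓘(ℝ, E) ∞ M›
  have : (tangentBundleCore 𝓘(ℝ, E) M).IsContMDiff 𝓘(ℝ, E) ∞ := tangentBundleCore.isContMDiff
  exact (tangentBundleCore 𝓘(ℝ, E) M).contMDiffOn_coordChange 𝓘(ℝ, E) (achart E a) (achart E b)

/-- The derivative of `trans a b` at `z`. -/
def dtrans (a b z : M) : E →L[ℝ] E →L[ℝ] E :=
  mfderiv 𝓘(ℝ, E) 𝓘(ℝ, E →L[ℝ] E) (trans (E := E) a b) z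

lemma hasChartDeriv_trans {a b z : M} (ha : z ∈ (chartAt E a).source)
    (hb : z ∈ (chartAt E b).source) : HasChartDeriv 𝓘(ℝ, E) (trans (E := E) a b) z (dtrans a b z) :=
  HasChartDeriv.of_hasMFDerivAt ((((contMDiffOn_trans a b).contMDiffAt
    (((chartAt E a).open_source.inter (chartAt E b).open_source).mem_nhds ⟨ha, hb⟩)).mdifferentiableAt
    (by simp)).hasMFDerivAt)

/-- The derivative of the relation `trans b a z ∘ trans a b z = id`. -/
lemma trans_dtrans {a b z : M} (ha : z ∈ (chartAt E a).source)
    (hb : z ∈ (chartAt E b).source) (u v : E) :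
    trans b a z (dtrans a b z u v) = - dtrans b a z u (trans a b z v) := by
  have h1 := (hasChartDeriv_trans hb ha).clm_apply
    ((hasChartDeriv_trans ha hb).clm_apply (HasChartDeriv.const v z))
  have h2 : HasChartDeriv 𝓘(ℝ, E) (fun w : M => trans b a w (trans a b w v)) z 0 := by
    refine (HasChartDeriv.const v z).congr ?_
    filter_upwards [((chartAt E a).open_source.inter (chartAt E b).open_source).mem_nhds ⟨ha, hb⟩]
      with w hw
    exact (trans_trans_cancel hw.1 hw.2 v).symm
  have h3 := congrArg (fun A : E →L[ℝ] E => A u) (h1.unique h2)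
  simp at h3
  exact eq_neg_of_add_eq_zero_left h3

lemma hasChartDeriv_extChartAt {a z : M} (h : z ∈ (chartAt E a).source) :
    HasChartDeriv 𝓘(ℝ, E) (extChartAt 𝓘(ℝ, E) a) z (trans z a z) := by
  have := hasFDerivWithinAt_tangentCoordChange (I := 𝓘(ℝ, E)) (x := z) (y := a) (z := z)
    (by simpa using h)
  rw [ModelWithCorners.range_eq_univ, hasFDerivWithinAt_univ] at this
  exact this

/-- A bundle of linear maps is trivialized through the inverse trivialization of its source bundle;
this identifies that inverse with a transition derivative. -/
lemma symmL_pullback_tangent {N : Type*} [TopologicalSpace N] {EN HN : Type*}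
    [NormedAddCommGroup EN] [NormedSpace ℝ EN] [TopologicalSpace HN] [ChartedSpace HN N]
    {I : ModelWithCorners ℝ EN HN} (f : C^∞⟮I, N; 𝓘(ℝ, E), M⟯) {p q : N}
    (h : f q ∈ (chartAt E (f p)).source) (v : E) :
    (trivializationAt E (f *ᵖ (TangentSpace 𝓘(ℝ, E) : M → Type _)) p).symmL ℝ q v =
      trans (f p) (f q) (f q) v := by
  set e := trivializationAt E (f *ᵖ (TangentSpace 𝓘(ℝ, E) : M → Type _)) p
  have hq : q ∈ e.baseSet := h
  have h1 := e.continuousLinearMapAt_symmL (R := ℝ) hq v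
  rw [Trivialization.continuousLinearMapAt_apply_of_mem ℝ e hq] at h1
  let w : E := e.symmL ℝ q v
  have h2 : trans (f q) (f p) (f q) w = v := h1
  change w = _
  rw [← h2, trans_trans_cancel (mem_chart_source E (f q)) h]

/-- The matrix of a jet in the charts at the points `p.1` and `p.2`. -/
def jetCoord (p : M × M) (η : Jet1 E M) : E →L[ℝ] E :=
  (trivializationAt (E →L[ℝ] E) (fun p : M × M => SrcT E M p →L[ℝ] TgtT E M p) p η).2

lemma jetCoord_eq {p : M × M} {η : Jet1 E M} (hx : η.1.1 ∈ (chartAt E p.1).source)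
    (hy : η.1.2 ∈ (chartAt E p.2).source) :
    jetCoord p η = (trans η.1.2 p.2 η.1.2).comp ((lin η).comp (trans p.1 η.1.1 η.1.1)) := by
  refine ContinuousLinearMap.ext fun v => ?_
  have h1 := symmL_pullback_tangent
    (ContMDiffMap.fst : C^∞⟮𝓘(ℝ, E).prod 𝓘(ℝ, E), M × M; 𝓘(ℝ, E), M⟯) (p := p) (q := η.1) hx v
  have h2 := Trivialization.continuousLinearMapAt_apply_of_mem ℝ
    (trivializationAt E (TgtT E M) p) (b := η.1) hy
    (η.2 ((trivializationAt E (SrcT E M) p).symmL ℝ η.1 v))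
  refine h2.trans ?_
  exact congrArg (fun w : E => trans η.1.2 p.2 η.1.2 (lin η w)) h1

/-- Tangent vectors at `η` are by convention read in the charts at the source and target of `η`
itself, so no correction term appears. -/
lemma hasChartDeriv_lin (η : Jet1 E M) : HasChartDeriv (IJ1 E) (jetCoord η.1) η
    (ContinuousLinearMap.snd ℝ (E × E) (E →L[ℝ] E)) :=
  hasChartDeriv_fiberCoord η

lemma jetCoord_self (η : Jet1 E M) : jetCoord η.1 η = lin η := by
  rw [jetCoord_eq (mem_chart_source E _) (mem_chart_source E _),
    trans_self (mem_chart_source E _), trans_self (mem_chart_source E _)]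
  rfl

lemma eventually_mem_source {p : M × M} {η : Jet1 E M} (hx : η.1.1 ∈ (chartAt E p.1).source)
    (hy : η.1.2 ∈ (chartAt E p.2).source) :
    ∀ᶠ ζ : Jet1 E M in 𝓝 η, ζ.1.1 ∈ (chartAt E p.1).source ∧ ζ.1.2 ∈ (chartAt E p.2).source := by
  have h1 := ((alpha E M).contMDiff.continuous.continuousAt (x := η)).preimage_mem_nhds
    ((chartAt E p.1).open_source.mem_nhds hx)
  have h2 := ((beta E M).contMDiff.continuous.continuousAt (x := η)).preimage_mem_nhds
    ((chartAt E p.2).open_source.mem_nhds hy)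
  filter_upwards [h1, h2] with ζ h3 h4 using ⟨h3, h4⟩

/-- The derivative of the matrix of a jet in fixed charts. -/
lemma hasChartDeriv_jetCoord {p : M × M} {η : Jet1 E M} (hx : η.1.1 ∈ (chartAt E p.1).source)
    (hy : η.1.2 ∈ (chartAt E p.2).source) :
    ∃ C : (E × E) × (E →L[ℝ] E) →L[ℝ] E →L[ℝ] E,
      HasChartDeriv (IJ1 E) (jetCoord p) η C ∧ ∀ (U : (E × E) × (E →L[ℝ] E)) (v : E), C U v =
        dtrans η.1.2 p.2 η.1.2 U.1.2 (lin η (trans p.1 η.1.1 η.1.1 v)) +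
        trans η.1.2 p.2 η.1.2 (U.2 (trans p.1 η.1.1 η.1.1 v)) +
        trans η.1.2 p.2 η.1.2 (lin η (dtrans p.1 η.1.1 η.1.1 U.1.1 v)) := by
  have hx' := mem_chart_source E η.1.1
  have hy' := mem_chart_source E η.1.2
  have h1 := (hasChartDeriv_trans hx hx').comp_hasMFDerivAt (g := alpha E M)
    (hasMFDerivAt_alpha η)
  have h2 := (hasChartDeriv_trans hy' hy).comp_hasMFDerivAt (g := beta E M)
    (hasMFDerivAt_beta η)
  -- Near `η` the matrix in the charts at `p` is the matrix in the charts at `η.1`, composed on both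
  -- sides with transition derivatives. The product rule gives three terms.
  have h3 := h2.clm_comp ((hasChartDeriv_lin η).clm_comp h1)
  refine ⟨_, h3.congr ?_, fun U v => ?_⟩
  · filter_upwards [eventually_mem_source hx hy, eventually_mem_source hx' hy'] with ζ h h'
    have hx'' := mem_chart_source E ζ.1.1
    have hy'' := mem_chart_source E ζ.1.2
    rw [jetCoord_eq h.1 h.2, jetCoord_eq h'.1 h'.2]
    refine ContinuousLinearMap.ext fun v => ?_
    change trans η.1.2 p.2 ζ.1.2 (trans ζ.1.2 η.1.2 ζ.1.2 (lin ζ (trans η.1.1 ζ.1.1 ζ.1.1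
      (trans p.1 η.1.1 ζ.1.1 v)))) = trans ζ.1.2 p.2 ζ.1.2 (lin ζ (trans p.1 ζ.1.1 ζ.1.1 v))
    rw [trans_trans h.1 h'.1 hx'', trans_trans hy'' h'.2 h.2]
  · simp only [jetCoord_self]
    change trans η.1.2 p.2 η.1.2 (lin η (dtrans p.1 η.1.1 η.1.1 U.1.1 v) +
      U.2 (trans p.1 η.1.1 η.1.1 v)) +
        dtrans η.1.2 p.2 η.1.2 U.1.2 (lin η (trans p.1 η.1.1 η.1.1 v)) = _
    rw [map_add]
    abel

/-- The coordinates of a tangent vector of `Jet1` with respect to the charts at the source and the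
target of another jet. -/
lemma trivializationAt_tangent_jet {ξ η : Jet1 E M} (hx : η.1.1 ∈ (chartAt E ξ.1.1).source)
    (hy : η.1.2 ∈ (chartAt E ξ.1.2).source) (U : (E × E) × (E →L[ℝ] E)) :
    (trivializationAt ((E × E) × (E →L[ℝ] E)) (TangentSpace (IJ1 E) : Jet1 E M → Type _) ξ
      ⟨η, U⟩).2.1 = (trans η.1.1 ξ.1.1 η.1.1 U.1.1, trans η.1.2 ξ.1.2 η.1.2 U.1.2) ∧
    ∀ v, (trivializationAt ((E × E) × (E →L[ℝ] E)) (TangentSpace (IJ1 E) : Jet1 E M → Type _) ξ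
      ⟨η, U⟩).2.2 v =
        dtrans η.1.2 ξ.1.2 η.1.2 U.1.2 (lin η (trans ξ.1.1 η.1.1 η.1.1 v)) +
        trans η.1.2 ξ.1.2 η.1.2 (U.2 (trans ξ.1.1 η.1.1 η.1.1 v)) +
        trans η.1.2 ξ.1.2 η.1.2 (lin η (dtrans ξ.1.1 η.1.1 η.1.1 U.1.1 v)) := by
  obtain ⟨C, hC, h⟩ := hasChartDeriv_jetCoord (p := ξ.1) hx hy
  have h1 := (hasChartDeriv_extChartAt hx).comp_hasMFDerivAt (g := alpha E M)
    (hasMFDerivAt_alpha η)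
  have h2 := (hasChartDeriv_extChartAt hy).comp_hasMFDerivAt (g := beta E M)
    (hasMFDerivAt_beta η)
  have hs : η.1 ∈ (chartAt (ModelProd E E) ξ.1).source := ⟨hx, hy⟩
  have h3 := (h1.prodMk h2).congr
      (g := fun r : Jet1 E M => extChartAt (𝓘(ℝ, E).prod 𝓘(ℝ, E)) ξ.1 r.1)
      (Filter.Eventually.of_forall fun r => by simp only [extChartAt_prod]; rfl)
  have hs' : η.1 ∈ (trivializationAt (E →L[ℝ] E)
      (fun p : M × M => SrcT E M p →L[ℝ] TgtT E M p) ξ.1).baseSet := ⟨hx, hy⟩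
  have h4 := trivializationAt_tangent_totalSpace (p := ξ) (q := η) hs hs' h3 hC U
  rw [h4]
  exact ⟨rfl, h U⟩

/-- The coordinates of a linear map from the tangent space at the source of a jet to the tangent
space of `Jet1`. -/
def jetCoord₂ (ξ : Jet1 E M) (j : Jet2 E M) : E →L[ℝ] (E × E) × (E →L[ℝ] E) :=
  (trivializationAt (E →L[ℝ] (E × E) × (E →L[ℝ] E))
    (fun ξ : Jet1 E M => AlphaT E M ξ →L[ℝ] TangentSpace (IJ1 E) ξ) ξ j).2

lemma mem_chart_source_jet {ξ η : Jet1 E M} (hx : η.1.1 ∈ (chartAt E ξ.1.1).source)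
    (hy : η.1.2 ∈ (chartAt E ξ.1.2).source) :
    η ∈ (chartAt (ModelProd (ModelProd E E) (E →L[ℝ] E)) ξ).source :=
  mem_chart_source_totalSpace (p := ξ) (q := η) (show η.1 ∈ _ from ⟨hx, hy⟩)
    (show η.1 ∈ (trivializationAt (E →L[ℝ] E)
      (fun p : M × M => SrcT E M p →L[ℝ] TgtT E M p) ξ.1).baseSet from ⟨hx, hy⟩)

lemma mem_source_jet₂ {ξ : Jet1 E M} {j : Jet2 E M} (hx : j.1.1.1 ∈ (chartAt E ξ.1.1).source)
    (hy : j.1.1.2 ∈ (chartAt E ξ.1.2).source) :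
    j ∈ (trivializationAt (E →L[ℝ] (E × E) × (E →L[ℝ] E))
      (fun ξ : Jet1 E M => AlphaT E M ξ →L[ℝ] TangentSpace (IJ1 E) ξ) ξ).source :=
  (Trivialization.mem_source _).2 ⟨hx, mem_chart_source_jet hx hy⟩

lemma jetCoord₂_apply {ξ : Jet1 E M} {j : Jet2 E M} (hx : j.1.1.1 ∈ (chartAt E ξ.1.1).source)
    (hy : j.1.1.2 ∈ (chartAt E ξ.1.2).source) (v : E) :
    jetCoord₂ ξ j v = (trivializationAt ((E × E) × (E →L[ℝ] E))
      (TangentSpace (IJ1 E) : Jet1 E M → Type _) ξ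
      ⟨j.1, j.2 (trans ξ.1.1 j.1.1.1 j.1.1.1 v : E)⟩).2 := by
  have h1 := symmL_pullback_tangent (alpha E M) (p := ξ) (q := j.1) hx v
  have hs : j.1 ∈ (trivializationAt ((E × E) × (E →L[ℝ] E))
      (TangentSpace (IJ1 E) : Jet1 E M → Type _) ξ).baseSet :=
    mem_chart_source_jet hx hy
  have h2 := Trivialization.continuousLinearMapAt_apply_of_mem ℝ
    (trivializationAt ((E × E) × (E →L[ℝ] E)) (TangentSpace (IJ1 E) : Jet1 E M → Type _) ξ) hs
    (j.2 ((trivializationAt E (AlphaT E M) ξ).symmL ℝ j.1 v))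
  refine Eq.trans h2 ?_
  rw [h1]
  rfl

section Instances
set_option synthInstance.maxHeartbeats 400000
variable (E M)

instance : ContMDiffVectorBundle ∞ E (AlphaT E M) (IJ1 E) := inferInstance

instance : ContMDiffVectorBundle ∞ (E →L[ℝ] (E × E) × (E →L[ℝ] E))
    (fun ξ : Jet1 E M => AlphaT E M ξ →L[ℝ] TangentSpace (IJ1 E) ξ) (IJ1 E) :=
  inferInstance

end Instances

set_option synthInstance.maxHeartbeats 400000 in
set_option maxHeartbeats 1000000 in
lemma contMDiffOn_jetCoord₂ {EN HN N : Type*} [NormedAddCommGroup EN] [NormedSpace ℝ EN]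
    [TopologicalSpace HN] {I : ModelWithCorners ℝ EN HN} [TopologicalSpace N] [ChartedSpace HN N]
    {s : Set N} {f : N → Jet2 E M} (hf : ContMDiffOn I (IJ2 E) ∞ f s) (ξ : Jet1 E M)
    (hs : ∀ x ∈ s, (f x).1.1.1 ∈ (chartAt E ξ.1.1).source ∧
      (f x).1.1.2 ∈ (chartAt E ξ.1.2).source) :
    ContMDiffOn I 𝓘(ℝ, E →L[ℝ] (E × E) × (E →L[ℝ] E)) ∞ (fun x => jetCoord₂ ξ (f x)) s := by
  have h : MapsTo f s (trivializationAt (E →L[ℝ] (E × E) × (E →L[ℝ] E))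
      (fun ξ : Jet1 E M => AlphaT E M ξ →L[ℝ] TangentSpace (IJ1 E) ξ) ξ).source :=
    fun x hx => mem_source_jet₂ (hs x hx).1 (hs x hx).2
  have h1 := Trivialization.contMDiffOn_iff (n := ∞) (IB := IJ1 E) (IM := I) (f := f) (s := s)
    (e := trivializationAt (E →L[ℝ] (E × E) × (E →L[ℝ] E))
      (fun ξ : Jet1 E M => AlphaT E M ξ →L[ℝ] TangentSpace (IJ1 E) ξ) ξ) h
  exact (h1.1 hf).2

end Transition

/-! ### Christoffel symbols and the coordinates of the affine extension. -/

section Christoffel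

variable {E : Type*} [NormedAddCommGroup E] [NormedSpace ℝ E]
  {M : Type*} [TopologicalSpace M] [ChartedSpace E M] [IsManifold 𝓘(ℝ, E) ∞ M]

namespace SymmetryJet
variable (𝔰 : SymmetryJet E M)

/-- The Christoffel symbol at `x` of the connection of the symmetry jet, in the chart at `a`. -/
def christoffel (a x : M) : E →L[ℝ] E →L[ℝ] E :=
  (ContinuousLinearMap.compL ℝ E E E (trans x a x)).comp
    ((dtrans a x x).comp (trans a x x) - (1 / 2 : ℝ) •
      ((ContinuousLinearMap.compL ℝ E E E).flip (trans a x x)).comp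
        ((𝔰.coef x).comp (trans a x x)))

lemma christoffel_apply (a x : M) (u v : E) : 𝔰.christoffel a x u v =
    trans x a x (dtrans a x x (trans a x x u) v -
      (1 / 2 : ℝ) • 𝔰.coef x (trans a x x u) (trans a x x v)) := rfl

lemma affineJet_apply (ξ : Jet1 E M) (v : E) :
    𝔰.affineJet ξ v = (((v, lin ξ v), (1 / 2 : ℝ) • ((𝔰.coef ξ.1.2 (lin ξ v)).comp (lin ξ)
      - (lin ξ).comp (𝔰.coef ξ.1.1 v))) : (E × E) × (E →L[ℝ] E)) :=
  (𝔰.isAffine_iff ξ _).1 (𝔰.existsUnique_isAffine ξ).choose_spec.1 v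

/-- The coordinates of the affine extension of a jet, in the charts at the source and the target of
another jet. -/
lemma jetCoord₂_S {ξ η : Jet1 E M} (hx : η.1.1 ∈ (chartAt E ξ.1.1).source)
    (hy : η.1.2 ∈ (chartAt E ξ.1.2).source) (v : E) :
    jetCoord₂ ξ (𝔰.S η) v = ((v, jetCoord ξ.1 η v),
      (jetCoord ξ.1 η).comp (𝔰.christoffel ξ.1.1 η.1.1 v) -
      (𝔰.christoffel ξ.1.2 η.1.2 (jetCoord ξ.1 η v)).comp (jetCoord ξ.1 η)) := by
  have hx' := mem_chart_source E η.1.1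
  have hy' := mem_chart_source E η.1.2
  have h1 := jetCoord₂_apply (ξ := ξ) (j := 𝔰.S η) hx hy v
  have h2 := 𝔰.affineJet_apply η (trans ξ.1.1 η.1.1 η.1.1 v)
  obtain ⟨h3, h4⟩ := trivializationAt_tangent_jet hx hy
    ((((trans ξ.1.1 η.1.1 η.1.1 v, lin η (trans ξ.1.1 η.1.1 η.1.1 v)), (1 / 2 : ℝ) •
      ((𝔰.coef η.1.2 (lin η (trans ξ.1.1 η.1.1 η.1.1 v))).comp (lin η)
      - (lin η).comp (𝔰.coef η.1.1 (trans ξ.1.1 η.1.1 η.1.1 v)))) : (E × E) × (E →L[ℝ] E)))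
  have h5 : jetCoord₂ ξ (𝔰.S η) v = (trivializationAt ((E × E) × (E →L[ℝ] E))
      (TangentSpace (IJ1 E) : Jet1 E M → Type _) ξ ⟨η, _⟩).2 := h1.trans
    (congrArg (fun U : (E × E) × (E →L[ℝ] E) => (trivializationAt ((E × E) × (E →L[ℝ] E))
      (TangentSpace (IJ1 E) : Jet1 E M → Type _) ξ ⟨η, U⟩).2) h2)
  rw [← h5] at h3
  have h6 : ∀ w, _ := fun w => (congrArg (fun U : (E × E) × (E →L[ℝ] E) => U.2 w) h5).trans (h4 w)
  have h7 : ∀ w, jetCoord ξ.1 η w =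
      trans η.1.2 ξ.1.2 η.1.2 (lin η (trans ξ.1.1 η.1.1 η.1.1 w)) := fun w => by
    rw [jetCoord_eq hx hy]; rfl
  refine Prod.ext ?_ (ContinuousLinearMap.ext fun w => (h6 w).trans ?_)
  · rw [h3, h7]
    exact Prod.ext (trans_trans_cancel hx hx' v) rfl
  · have h8 := trans_dtrans hy hy' (lin η (trans ξ.1.1 η.1.1 η.1.1 v)) (jetCoord ξ.1 η w)
    have h9 : trans ξ.1.2 η.1.2 η.1.2 (jetCoord ξ.1 η w) = lin η (trans ξ.1.1 η.1.1 η.1.1 w) := by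
      rw [h7, trans_trans_cancel hy' hy]
    have h10 : trans ξ.1.2 η.1.2 η.1.2 (jetCoord ξ.1 η v) =
      lin η (trans ξ.1.1 η.1.1 η.1.1 v) := by rw [h7, trans_trans_cancel hy' hy]
    rw [h9] at h8
    simp only [_root_.sub_apply, ContinuousLinearMap.comp_apply,
      _root_.smul_apply]
    rw [h7 (𝔰.christoffel _ _ _ _), christoffel_apply, christoffel_apply, h9, h10,
      trans_trans_cancel hx' hx]
    simp only [map_sub, map_smul, smul_sub, h8]
    abel

/-- The affine extension really extends 𝔰: by bilinearity, `𝔰.jet x` satisfies the affine equation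
over −I, and affine jets are unique. -/
lemma S_negJet (x : M) : 𝔰.S (negJet x) = ⟨negJet x, 𝔰.jet x⟩ := by
  have h : 𝔰.IsAffine (negJet x) (𝔰.jet x) := by
    refine (𝔰.isAffine_iff (negJet x) (𝔰.jet x)).2 fun v => ?_
    have hl : ∀ u, lin (negJet (E := E) x) u = -u := fun u => rfl
    refine Prod.ext (Prod.ext ?_ ?_) ?_
    · exact (mfderiv_alpha_apply _ _).symm.trans (𝔰.alpha_jet x v)
    · exact (mfderiv_beta_apply _ _).symm.trans (𝔰.beta_jet x v)
    · refine ContinuousLinearMap.ext fun w => ?_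
      change 𝔰.coef x v w = (1 / 2 : ℝ) • (𝔰.coef x (lin (negJet x) v) (lin (negJet x) w) -
        lin (negJet x) (𝔰.coef x v w))
      rw [hl, hl, hl, map_neg, map_neg, _root_.neg_apply]
      module
  exact congrArg (fun L => (⟨negJet x, L⟩ : Jet2 E M))
    ((𝔰.existsUnique_isAffine (negJet x)).unique
      (𝔰.existsUnique_isAffine (negJet x)).choose_spec.1 h)

/-- For A = −I the second order part A Γ(v, ·) − Γ(A v, A ·) is −2 Γ(v, ·). The symbol can thus be
recovered from the smooth section 𝔰. -/
lemma jetCoord₂_jet {a x : M} (hx : x ∈ (chartAt E a).source) (v : E) :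
    (jetCoord₂ (negJet a) (⟨negJet x, 𝔰.jet x⟩ : Jet2 E M) v).2 =
      (-2 : ℝ) • 𝔰.christoffel a x v := by
  have h : ∀ w : E, jetCoord (negJet (E := E) a).1 (negJet (E := E) x) w = -w := fun w => by
    rw [jetCoord_eq (p := (negJet (E := E) a).1) (η := negJet (E := E) x) hx hx]
    change trans x a x (-(trans a x x w)) = -w
    rw [map_neg, trans_trans_cancel hx (mem_chart_source E x)]
  rw [← S_negJet, jetCoord₂_S (ξ := negJet a) (η := negJet x) 𝔰 hx hx]
  refine ContinuousLinearMap.ext fun w => ?_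
  simp only [_root_.sub_apply, ContinuousLinearMap.comp_apply,
      _root_.smul_apply, h, map_neg, _root_.neg_apply]
  change - 𝔰.christoffel a x v w - - - 𝔰.christoffel a x v w = _
  module

lemma contMDiffOn_christoffel (a : M) :
    ContMDiffOn 𝓘(ℝ, E) 𝓘(ℝ, E →L[ℝ] E →L[ℝ] E) ∞ (𝔰.christoffel a) (chartAt E a).source := by
  have h1 : ContMDiffOn 𝓘(ℝ, E) 𝓘(ℝ, E →L[ℝ] (E × E) × (E →L[ℝ] E)) ∞
      (fun x => jetCoord₂ (negJet a) (⟨negJet x, 𝔰.jet x⟩ : Jet2 E M)) (chartAt E a).source :=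
    contMDiffOn_jetCoord₂ 𝔰.smooth.contMDiffOn (negJet a) fun x hx => ⟨hx, hx⟩
  have h2 : ContMDiffOn 𝓘(ℝ, E) 𝓘(ℝ, E →L[ℝ] E →L[ℝ] E) ∞
      (fun x => ((-1 / 2 : ℝ) • ContinuousLinearMap.snd ℝ (E × E) (E →L[ℝ] E)).comp
        (jetCoord₂ (negJet a) (⟨negJet x, 𝔰.jet x⟩ : Jet2 E M))) (chartAt E a).source :=
    contMDiffOn_const.clm_comp h1
  refine h2.congr fun x hx => ?_
  refine ContinuousLinearMap.ext fun v => ?_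
  change _ = (-1 / 2 : ℝ) • (jetCoord₂ (negJet a) (⟨negJet x, 𝔰.jet x⟩ : Jet2 E M) v).2
  rw [jetCoord₂_jet 𝔰 hx]
  module

end SymmetryJet

end Christoffel

/-! ### Torsion and curvature in terms of Christoffel symbols. -/

section Curvature

variable {E : Type*} [NormedAddCommGroup E] [NormedSpace ℝ E]
  {M : Type*} [TopologicalSpace M] [ChartedSpace E M] [IsManifold 𝓘(ℝ, E) ∞ M]

lemma HasChartDeriv.mvfderiv_apply {EN HN N F : Type*} [NormedAddCommGroup EN] [NormedSpace ℝ EN]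
    [TopologicalSpace HN] {I : ModelWithCorners ℝ EN HN} [TopologicalSpace N] [ChartedSpace HN N]
    [NormedAddCommGroup F] [NormedSpace ℝ F] {f : N → F} {x : N} {A : EN →L[ℝ] F}
    (h : HasChartDeriv I f x A) (v : EN) : mvfderiv I f x v = A v :=
  congrArg (fun B : EN →L[ℝ] F => B v) h.hasMFDerivAt.mfderiv

/-- The vector field that extends `w ∈ T_a M` with constant coordinates in the chart at `a`. -/
def constField (a : M) (w : E) : ∀ y : M, TangentSpace 𝓘(ℝ, E) y :=
  FiberBundle.extend E (x := a) (show TangentSpace 𝓘(ℝ, E) a from w)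

lemma constField_apply {a y : M} (h : y ∈ (chartAt E a).source) (w : E) :
    constField a w y = trans a y y w := by
  have h1 : trans a a a w = w := by rw [trans_self (mem_chart_source E a)]; rfl
  have h2 := (Trivialization.symmL_apply (R := ℝ)
    (trivializationAt E (TangentSpace 𝓘(ℝ, E) : M → Type _) a) (b := y) h (trans a a a w))
  refine Eq.trans h2.symm ?_
  rw [TangentBundle.symmL_trivializationAt_eq_core h, h1]
  rfl

/-- Covariant derivatives at `y` use the chart at `y`, where a field constant in the chart at `a` is
no longer constant: its derivative is the `dtrans` term of `christoffel a y`. -/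
lemma fieldCoord_constField {a y : M} (h : y ∈ (chartAt E a).source) (w : E) :
    (fun z => trans (E := E) a y z w) =ᶠ[𝓝 y] fieldCoord y (constField a w) := by
  filter_upwards [(chartAt E a).open_source.mem_nhds h, chart_source_mem_nhds E y] with z hz hz'
  change _ = trans (E := E) z y z (constField a w z)
  rw [constField_apply hz]
  exact (trans_trans hz (mem_chart_source E z) hz' w).symm

lemma hasChartDeriv_fieldCoord_constField {a y : M} (h : y ∈ (chartAt E a).source) (w : E) :
    HasChartDeriv 𝓘(ℝ, E) (fieldCoord y (constField a w)) y ((dtrans a y y).flip w) := by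
  have h1 := ((hasChartDeriv_trans h (mem_chart_source E y)).clm_apply
    (HasChartDeriv.const w y)).congr (fieldCoord_constField h w)
  rwa [ContinuousLinearMap.comp_zero, zero_add] at h1

lemma mdifferentiableAt_of_fieldCoord {σ : ∀ y : M, TangentSpace 𝓘(ℝ, E) y} {y : M}
    {A : E →L[ℝ] E} (h : HasChartDeriv 𝓘(ℝ, E) (fieldCoord y σ) y A) : MDiffAt (T% σ) y :=
  (mdifferentiableAt_section (IB := 𝓘(ℝ, E)) (F := E) σ).2 h.hasMFDerivAt.mdifferentiableAt

lemma dtrans_self (a : M) : dtrans (E := E) a a a = 0 := by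
  refine (hasChartDeriv_trans (mem_chart_source E a) (mem_chart_source E a)).unique
    ((HasChartDeriv.const (ContinuousLinearMap.id ℝ E) a).congr ?_)
  filter_upwards [chart_source_mem_nhds E a] with z hz using (trans_self hz).symm

lemma mlieBracket_constField (a : M) (u v : E) :
    VectorField.mlieBracket 𝓘(ℝ, E) (constField a u) (constField a v) a = 0 := by
  have h := mem_chart_source E a
  refine (mlieBracket_eq_of_hasChartDeriv (hasChartDeriv_fieldCoord_constField h u)
    (hasChartDeriv_fieldCoord_constField h v)).trans ?_
  rw [dtrans_self]
  exact sub_zero (0 : E)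

namespace SymmetryJet
set_option synthInstance.maxHeartbeats 400000
variable (𝔰 : SymmetryJet E M)

lemma christoffel_self (a : M) : 𝔰.christoffel a a = (-1 / 2 : ℝ) • 𝔰.coef a := by
  ext u v
  rw [christoffel_apply, trans_self (mem_chart_source E a), dtrans_self]
  change (0 : E) - (1 / 2 : ℝ) • 𝔰.coef a u v = (-1 / 2 : ℝ) • 𝔰.coef a u v
  module

lemma nabla_apply {σ : ∀ y : M, TangentSpace 𝓘(ℝ, E) y} {x : M} {A : E →L[ℝ] E}
    (h : HasChartDeriv 𝓘(ℝ, E) (fieldCoord x σ) x A) (v : E) :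
    𝔰.nabla σ x v = (A v - (1 / 2 : ℝ) • 𝔰.coef x v (σ x) : E) := by
  refine (𝔰.nablaAt_apply (mdifferentiableAt_of_fieldCoord h) v).trans ?_
  rw [h.mvfderiv_apply v]

lemma nabla_apply_self {σ : ∀ y : M, TangentSpace 𝓘(ℝ, E) y} {x : M} {A : E →L[ℝ] E}
    (h : HasChartDeriv 𝓘(ℝ, E) (fieldCoord x σ) x A) (v : E) :
    𝔰.nabla σ x v = (A v + 𝔰.christoffel x x v (σ x) : E) := by
  rw [𝔰.nabla_apply h, christoffel_self]
  change A v - (1 / 2 : ℝ) • 𝔰.coef x v (σ x) = A v + (-1 / 2 : ℝ) • 𝔰.coef x v (σ x)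
  module

/-- The covariant derivative of a field with constant coordinates along another one. -/
lemma fieldCoord_nabla_constField (a : M) (v w : E) :
    (fun y => 𝔰.christoffel a y v w) =ᶠ[𝓝 a]
      fieldCoord a (fun y => 𝔰.nabla (constField a w) y (constField a v y)) := by
  filter_upwards [chart_source_mem_nhds E a] with y hy
  change _ = trans (E := E) y a y (𝔰.nabla (constField a w) y (constField a v y))
  rw [christoffel_apply, constField_apply hy]
  have h := 𝔰.nabla_apply (hasChartDeriv_fieldCoord_constField hy w) (trans a y y v)
  rw [constField_apply hy] at h
  exact congrArg _ h.symm

/-- The derivative at `a` of the Christoffel symbol in the chart at `a`. -/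
def dchristoffel (a : M) : E →L[ℝ] E →L[ℝ] E →L[ℝ] E :=
  mfderiv 𝓘(ℝ, E) 𝓘(ℝ, E →L[ℝ] E →L[ℝ] E) (𝔰.christoffel a) a

lemma hasChartDeriv_christoffel (a : M) :
    HasChartDeriv 𝓘(ℝ, E) (𝔰.christoffel a) a (𝔰.dchristoffel a) :=
  HasChartDeriv.of_hasMFDerivAt (((𝔰.contMDiffOn_christoffel a).contMDiffAt
    (chart_source_mem_nhds E a)).mdifferentiableAt (by simp)).hasMFDerivAt

lemma nabla_nabla_constField (a : M) (u v w : E) :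
    𝔰.nabla (fun y => 𝔰.nabla (constField a w) y (constField a v y)) a u =
      (𝔰.dchristoffel a u v w + 𝔰.christoffel a a u (𝔰.christoffel a a v w) : E) := by
  have h := (((𝔰.hasChartDeriv_christoffel a).clm_apply (HasChartDeriv.const v a)).clm_apply
    (HasChartDeriv.const w a)).congr (𝔰.fieldCoord_nabla_constField a v w)
  have h1 : (fun y => 𝔰.nabla (constField a w) y (constField a v y)) a =
      (𝔰.christoffel a a v w : E) := by
    have h2 := (𝔰.fieldCoord_nabla_constField a v w).self_of_nhds
    exact ((fieldCoord_self a _).symm.trans h2.symm)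
  rw [𝔰.nabla_apply_self h]
  refine (congrArg (fun z : E => _ + 𝔰.christoffel a a u z) h1).trans ?_
  simp

/-- The extensions in the definition of `curvature` are the constant fields of the chart at `a`.
Their bracket vanishes at `a`, so only the second covariant derivatives remain. -/
lemma curvature_eq (a : M) (u v w : E) :
    curvature 𝔰.nabla a u v w = (𝔰.dchristoffel a u v w - 𝔰.dchristoffel a v u w +
      𝔰.christoffel a a u (𝔰.christoffel a a v w) -
      𝔰.christoffel a a v (𝔰.christoffel a a u w) : E) := by
  have hu : constField a u a = u := FiberBundle.extend_apply_self (F := E) _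
  have hv : constField a v a = v := FiberBundle.extend_apply_self (F := E) _
  have h1 := 𝔰.nabla_nabla_constField a u v w
  have h2 := 𝔰.nabla_nabla_constField a v u w
  have h3 : curvature 𝔰.nabla a u v w =
    (𝔰.nabla (fun y => 𝔰.nabla (constField a w) y (constField a v y)) a (constField a u a) -
    𝔰.nabla (fun y => 𝔰.nabla (constField a w) y (constField a u y)) a (constField a v a) -
    𝔰.nabla (constField a w) a
      (VectorField.mlieBracket 𝓘(ℝ, E) (constField a u) (constField a v) a) : E) := rfl
  rw [h3, mlieBracket_constField, hu, hv, h1, h2]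
  rw [map_zero]
  change (_ - _ - (0 : E) : E) = _
  abel

lemma torsion_eq [FiniteDimensional ℝ E] [CompleteSpace E] [IsManifold 𝓘(ℝ, E) 2 M]
    (a : M) (u v : E) :
    𝔰.nabla.torsion a u v = (𝔰.christoffel a a u v - 𝔰.christoffel a a v u : E) := by
  have h := mem_chart_source E a
  have hu : constField a u a = u := FiberBundle.extend_apply_self (F := E) _
  have hv : constField a v a = v := FiberBundle.extend_apply_self (F := E) _
  have h3 : 𝔰.nabla.torsion a u v =
    (𝔰.nabla (constField a v) a (constField a u a) -
    𝔰.nabla (constField a u) a (constField a v a) -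
      (VectorField.mlieBracket 𝓘(ℝ, E) (constField a u) (constField a v) a) : E) :=
    𝔰.nabla.torsion_apply_eq_extend (x := a) u v
  rw [h3, mlieBracket_constField, hu, hv,
    𝔰.nabla_apply_self (hasChartDeriv_fieldCoord_constField h v),
    𝔰.nabla_apply_self (hasChartDeriv_fieldCoord_constField h u), hu, hv, dtrans_self]
  change (0 + _ - (0 + _) - (0 : E) : E) = _
  simp

end SymmetryJet

end Curvature

/-! ### Smoothness of the affine extension and its derivative. -/

section AffineExtension

variable {E : Type*} [NormedAddCommGroup E] [NormedSpace ℝ E]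
  {M : Type*} [TopologicalSpace M] [ChartedSpace E M] [IsManifold 𝓘(ℝ, E) ∞ M]

lemma contMDiffOn_jetCoord (p : M × M) :
    ContMDiffOn (IJ1 E) 𝓘(ℝ, E →L[ℝ] E) ∞ (jetCoord (E := E) p)
      {η | η.1.1 ∈ (chartAt E p.1).source ∧ η.1.2 ∈ (chartAt E p.2).source} := by
  have h := Trivialization.contMDiffOn (n := ∞) (IB := 𝓘(ℝ, E).prod 𝓘(ℝ, E))
    (trivializationAt (E →L[ℝ] E) (fun p : M × M => SrcT E M p →L[ℝ] TgtT E M p) p)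
  exact (contMDiff_snd.comp_contMDiffOn h).mono fun η hη => (Trivialization.mem_source _).2 hη

lemma isOpen_jet_source (p : M × M) : IsOpen {η : Jet1 E M |
    η.1.1 ∈ (chartAt E p.1).source ∧ η.1.2 ∈ (chartAt E p.2).source} :=
  isOpen_iff_mem_nhds.2 fun _ h => eventually_mem_source h.1 h.2

lemma invertibleJets_mem_nhds [CompleteSpace E] {ξ : Jet1 E M} (h : ξ ∈ invertibleJets E M) :
    invertibleJets E M ∈ 𝓝 ξ := by
  have hx := mem_chart_source E ξ.1.1
  have hy := mem_chart_source E ξ.1.2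
  obtain ⟨e, he⟩ : ∃ e : E ≃L[ℝ] E, (e : E →L[ℝ] E) = lin ξ := h
  have h1 : range ((↑) : (E ≃L[ℝ] E) → E →L[ℝ] E) ∈ 𝓝 (jetCoord ξ.1 ξ) := by
    rw [jetCoord_self, ← he]
    exact ContinuousLinearEquiv.nhds e
  filter_upwards [(hasChartDeriv_lin ξ).continuousAt.preimage_mem_nhds h1,
    eventually_mem_source hx hy] with η ⟨g, hg⟩ hη
  have hx' := mem_chart_source E η.1.1
  have hy' := mem_chart_source E η.1.2
  let tr : ∀ {a b z : M} (_ : z ∈ (chartAt E a).source) (_ : z ∈ (chartAt E b).source), E ≃L[ℝ] E :=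
    fun {a b z} ha hb => ContinuousLinearEquiv.equivOfInverse (trans a b z) (trans b a z)
      (trans_trans_cancel ha hb) (trans_trans_cancel hb ha)
  -- Invertibility is open for matrices in the fixed charts at `ξ`; conjugating by the transition
  -- isomorphisms brings the inverse back to `η`.
  have key : (((tr hx' hη.1).trans g).trans (tr hη.2 hy') : E →L[ℝ] E) = lin η := by
    refine ContinuousLinearMap.ext fun v => ?_
    change trans ξ.1.2 η.1.2 η.1.2 (g (trans η.1.1 ξ.1.1 η.1.1 v)) = _
    have h2 : g (trans η.1.1 ξ.1.1 η.1.1 v) = jetCoord ξ.1 η (trans η.1.1 ξ.1.1 η.1.1 v) := by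
      rw [← hg]; rfl
    rw [h2, jetCoord_eq hη.1 hη.2]
    change trans ξ.1.2 η.1.2 η.1.2 (trans η.1.2 ξ.1.2 η.1.2 (lin η
      (trans ξ.1.1 η.1.1 η.1.1 (trans η.1.1 ξ.1.1 η.1.1 v)))) = _
    rw [trans_trans_cancel hy' hη.2, trans_trans_cancel hx' hη.1]
  exact ⟨((tr hx' hη.1).trans g).trans (tr hη.2 hy'), key⟩

namespace SymmetryJet
set_option synthInstance.maxHeartbeats 400000
variable (𝔰 : SymmetryJet E M)

/-- The affine extension in the charts at the source and the target of `ξ`. -/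
def affineCoord (ξ η : Jet1 E M) : E →L[ℝ] (E × E) × (E →L[ℝ] E) := jetCoord₂ ξ (𝔰.S η)

set_option maxHeartbeats 1000000 in
lemma contMDiffOn_affineCoord (ξ : Jet1 E M) :
    ContMDiffOn (IJ1 E) 𝓘(ℝ, E →L[ℝ] (E × E) × (E →L[ℝ] E)) ∞ (𝔰.affineCoord ξ)
      {η | η.1.1 ∈ (chartAt E ξ.1.1).source ∧ η.1.2 ∈ (chartAt E ξ.1.2).source} := by
  set s : Set (Jet1 E M) :=
    {η | η.1.1 ∈ (chartAt E ξ.1.1).source ∧ η.1.2 ∈ (chartAt E ξ.1.2).source}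
  have h0 := contMDiffOn_jetCoord (E := E) ξ.1
  have h1 : ContMDiffOn (IJ1 E) 𝓘(ℝ, E →L[ℝ] E →L[ℝ] E) ∞
      (fun η : Jet1 E M => 𝔰.christoffel ξ.1.1 η.1.1) s :=
    (𝔰.contMDiffOn_christoffel ξ.1.1).comp (alpha E M).contMDiff.contMDiffOn fun η h => h.1
  have h2 : ContMDiffOn (IJ1 E) 𝓘(ℝ, E →L[ℝ] E →L[ℝ] E) ∞
      (fun η : Jet1 E M => 𝔰.christoffel ξ.1.2 η.1.2) s :=
    (𝔰.contMDiffOn_christoffel ξ.1.2).comp (beta E M).contMDiff.contMDiffOn fun η h => h.2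
  -- By `jetCoord₂_S` the affine extension is a polynomial in the matrix of the jet and the two
  -- Christoffel symbols.
  let Φ : (E →L[ℝ] E) × (E →L[ℝ] E →L[ℝ] E) × (E →L[ℝ] E →L[ℝ] E) →
      E →L[ℝ] (E × E) × (E →L[ℝ] E) := fun q =>
    ((ContinuousLinearMap.id ℝ E).prod q.1).prod
      ((ContinuousLinearMap.compL ℝ E E E q.1).comp q.2.1 -
        ((ContinuousLinearMap.compL ℝ E E E).flip q.1).comp (q.2.2.comp q.1))
  have hΦ : ContDiff ℝ ∞ Φ := by
    have e0 : ContDiff ℝ ∞ fun q : (E →L[ℝ] E) × (E →L[ℝ] E →L[ℝ] E) × (E →L[ℝ] E →L[ℝ] E) => q.1 :=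
      contDiff_fst
    have e1 : ContDiff ℝ ∞ fun q : (E →L[ℝ] E) × (E →L[ℝ] E →L[ℝ] E) × (E →L[ℝ] E →L[ℝ] E) =>
        q.2.1 := contDiff_fst.comp contDiff_snd
    have e2 : ContDiff ℝ ∞ fun q : (E →L[ℝ] E) × (E →L[ℝ] E →L[ℝ] E) × (E →L[ℝ] E →L[ℝ] E) =>
        q.2.2 := contDiff_snd.comp contDiff_snd
    have e3 := ((ContinuousLinearMap.compL ℝ E E E).contDiff.comp e0).clm_comp e1
    have e4 := ((ContinuousLinearMap.compL ℝ E E E).flip.contDiff.comp e0).clm_comp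
      (e2.clm_comp e0)
    exact (ContinuousLinearMap.prodₗᵢ ℝ).contDiff.comp
      (((ContinuousLinearMap.prodₗᵢ ℝ).contDiff.comp
        ((contDiff_const (c := ContinuousLinearMap.id ℝ E)).prodMk e0)).prodMk (e3.sub e4))
  refine (hΦ.contMDiff.comp_contMDiffOn (h0.prodMk_space (h1.prodMk_space h2))).congr fun η h => ?_
  refine ContinuousLinearMap.ext fun v => ?_
  exact 𝔰.jetCoord₂_S h.1 h.2 v

/-- The derivative of the affine extension at `ξ`, in the charts at its source and its target. -/
def daffine (ξ : Jet1 E M) :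
    (E × E) × (E →L[ℝ] E) →L[ℝ] E →L[ℝ] (E × E) × (E →L[ℝ] E) :=
  mfderiv (IJ1 E) 𝓘(ℝ, E →L[ℝ] (E × E) × (E →L[ℝ] E)) (𝔰.affineCoord ξ) ξ

lemma hasChartDeriv_affineCoord (ξ : Jet1 E M) :
    HasChartDeriv (IJ1 E) (𝔰.affineCoord ξ) ξ (𝔰.daffine ξ) :=
  HasChartDeriv.of_hasMFDerivAt (((𝔰.contMDiffOn_affineCoord ξ).contMDiffAt
    ((isOpen_jet_source ξ.1).mem_nhds ⟨mem_chart_source E _, mem_chart_source E _⟩)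
    ).mdifferentiableAt (by simp)).hasMFDerivAt

lemma affineCoord_self_apply (ξ : Jet1 E M) (v : E) : 𝔰.affineCoord ξ ξ v = 𝔰.affineJet ξ v := by
  have h := mem_chart_source E ξ.1.1
  refine (jetCoord₂_apply (ξ := ξ) (j := 𝔰.S ξ) h (mem_chart_source E _) v).trans ?_
  have h1 : trans ξ.1.1 ξ.1.1 ξ.1.1 v = v := by rw [trans_self h]; rfl
  refine (congrArg (fun z : E => (trivializationAt ((E × E) × (E →L[ℝ] E))
      (TangentSpace (IJ1 E) : Jet1 E M → Type _) ξ ⟨ξ, 𝔰.affineJet ξ z⟩).2) h1).trans ?_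
  exact (tangentBundleCore (IJ1 E) (Jet1 E M)).coordChange_self (achart _ ξ) ξ
    (mem_chart_source _ ξ) _

lemma affineJet_fst (ξ : Jet1 E M) (v : E) :
    (𝔰.affineJet ξ v : (E × E) × (E →L[ℝ] E)).1 = (v, lin ξ v) :=
  congrArg Prod.fst (𝔰.affineJet_apply ξ v)

lemma affineJet_snd_apply (ξ : Jet1 E M) (v w : E) :
    (𝔰.affineJet ξ v : (E × E) × (E →L[ℝ] E)).2 w =
      lin ξ (𝔰.christoffel ξ.1.1 ξ.1.1 v w) -
        𝔰.christoffel ξ.1.2 ξ.1.2 (lin ξ v) (lin ξ w) := by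
  rw [← affineCoord_self_apply, affineCoord,
    jetCoord₂_S 𝔰 (mem_chart_source E _) (mem_chart_source E _), jetCoord_self]
  rfl

/-- This differentiates `jetCoord₂_S` at fixed `v`. The source component is the constant `v`, hence
the 0 that later makes brackets comparable modulo the distribution. -/
lemma daffine_apply (ξ : Jet1 E M) (U : (E × E) × (E →L[ℝ] E)) (v : E) :
    (𝔰.daffine ξ U v).1 = (0, U.2 v) ∧ ∀ w, (𝔰.daffine ξ U v).2 w =
      lin ξ (𝔰.dchristoffel ξ.1.1 U.1.1 v w) + U.2 (𝔰.christoffel ξ.1.1 ξ.1.1 v w)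
      - (𝔰.dchristoffel ξ.1.2 U.1.2 (lin ξ v) (lin ξ w)
        + 𝔰.christoffel ξ.1.2 ξ.1.2 (U.2 v) (lin ξ w)
        + 𝔰.christoffel ξ.1.2 ξ.1.2 (lin ξ v) (U.2 w)) := by
  have hx := mem_chart_source E ξ.1.1
  have hy := mem_chart_source E ξ.1.2
  have h1 := (𝔰.hasChartDeriv_affineCoord ξ).clm_apply (HasChartDeriv.const v ξ)
  have hv := (hasChartDeriv_lin ξ).clm_apply (HasChartDeriv.const v ξ)
  have hΓ := (((𝔰.hasChartDeriv_christoffel ξ.1.1).comp_hasMFDerivAt (g := alpha E M)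
    (hasMFDerivAt_alpha ξ)).clm_apply (HasChartDeriv.const v ξ))
  have hΓ' := ((𝔰.hasChartDeriv_christoffel ξ.1.2).comp_hasMFDerivAt (g := beta E M)
    (hasMFDerivAt_beta ξ)).clm_apply hv
  have hs := eventually_mem_source hx hy
  constructor
  · have h2 := HasChartDeriv.comp hasFDerivAt_fst h1
    have h3 := ((HasChartDeriv.const v ξ).prodMk hv).congr (g := fun η =>
      (𝔰.affineCoord ξ η v).1) (by
        filter_upwards [hs] with η hη
        exact (congrArg Prod.fst (𝔰.jetCoord₂_S hη.1 hη.2 v)).symm)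
    have h4 := congrArg (fun A : (E × E) × (E →L[ℝ] E) →L[ℝ] E × E => A U) (h2.unique h3)
    simp at h4
    exact h4
  · intro w
    have hw := (hasChartDeriv_lin ξ).clm_apply (HasChartDeriv.const w ξ)
    have h2 := (HasChartDeriv.comp hasFDerivAt_snd h1).clm_apply (HasChartDeriv.const w ξ)
    have h3 := (((hasChartDeriv_lin ξ).clm_apply (hΓ.clm_apply (HasChartDeriv.const w ξ))).sub
      (hΓ'.clm_apply hw)).congr (g := fun η => (𝔰.affineCoord ξ η v).2 w) (by
        filter_upwards [hs] with η hη
        exact (congrArg (fun z : (E × E) × (E →L[ℝ] E) => z.2 w)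
          (𝔰.jetCoord₂_S hη.1 hη.2 v)).symm)
    have h4 := congrArg (fun A : (E × E) × (E →L[ℝ] E) →L[ℝ] E => A U) (h2.unique h3)
    simp [jetCoord_self] at h4
    have key : ∀ a b c d e : E, a + b - (c + (d + e)) = a + b - (e + d + c) := by
      intros
      abel
    exact h4.trans (key _ _ _ _ _)

end SymmetryJet

end AffineExtension

/-! ### The symmetry condition: torsion and curvature, and κ-invariance. -/

section Kappa

variable {E : Type*} [NormedAddCommGroup E] [NormedSpace ℝ E]
  {M : Type*} [TopologicalSpace M] [ChartedSpace E M] [IsManifold 𝓘(ℝ, E) ∞ M]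

namespace SymmetryJet
set_option synthInstance.maxHeartbeats 400000
variable (𝔰 : SymmetryJet E M)

/-- The symmetry of the second derivative that characterizes the integrability at `ξ` of the affine
distribution. -/
def IsSymmAt (ξ : Jet1 E M) : Prop :=
  ∀ u v : E, 𝔰.daffine ξ (𝔰.affineJet ξ u) v = 𝔰.daffine ξ (𝔰.affineJet ξ v) u

lemma isSymmAt_iff (ξ : Jet1 E M) : 𝔰.IsSymmAt ξ ↔
    (∀ u v : E, 𝔰.christoffel ξ.1.2 ξ.1.2 (lin ξ u) (lin ξ v) -
        𝔰.christoffel ξ.1.2 ξ.1.2 (lin ξ v) (lin ξ u) =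
      lin ξ (𝔰.christoffel ξ.1.1 ξ.1.1 u v - 𝔰.christoffel ξ.1.1 ξ.1.1 v u)) ∧
    ∀ u v w : E, 𝔰.dchristoffel ξ.1.2 (lin ξ u) (lin ξ v) (lin ξ w) -
        𝔰.dchristoffel ξ.1.2 (lin ξ v) (lin ξ u) (lin ξ w) +
        𝔰.christoffel ξ.1.2 ξ.1.2 (lin ξ u) (𝔰.christoffel ξ.1.2 ξ.1.2 (lin ξ v) (lin ξ w)) -
        𝔰.christoffel ξ.1.2 ξ.1.2 (lin ξ v) (𝔰.christoffel ξ.1.2 ξ.1.2 (lin ξ u) (lin ξ w)) =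
      lin ξ (𝔰.dchristoffel ξ.1.1 u v w - 𝔰.dchristoffel ξ.1.1 v u w +
        𝔰.christoffel ξ.1.1 ξ.1.1 u (𝔰.christoffel ξ.1.1 ξ.1.1 v w) -
        𝔰.christoffel ξ.1.1 ξ.1.1 v (𝔰.christoffel ξ.1.1 ξ.1.1 u w)) := by
  let L : E → (E × E) × (E →L[ℝ] E) := fun u => 𝔰.affineJet ξ u
  have hL1 : ∀ u, (L u).1 = (u, lin ξ u) := 𝔰.affineJet_fst ξ
  have hL2 : ∀ u v, (L u).2 v = lin ξ (𝔰.christoffel ξ.1.1 ξ.1.1 u v) -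
        𝔰.christoffel ξ.1.2 ξ.1.2 (lin ξ u) (lin ξ v) := 𝔰.affineJet_snd_apply ξ
  have h1 : ∀ u v, (𝔰.daffine ξ (L u) v).1 = (0, (L u).2 v) := fun u v =>
    (𝔰.daffine_apply ξ (L u) v).1
  have h2 := fun u v => (𝔰.daffine_apply ξ (L u) v).2
  have hT : (∀ u v : E, (𝔰.daffine ξ (L u) v).1 = (𝔰.daffine ξ (L v) u).1) ↔
      (∀ u v : E, 𝔰.christoffel ξ.1.2 ξ.1.2 (lin ξ u) (lin ξ v) -
        𝔰.christoffel ξ.1.2 ξ.1.2 (lin ξ v) (lin ξ u) =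
      lin ξ (𝔰.christoffel ξ.1.1 ξ.1.1 u v - 𝔰.christoffel ξ.1.1 ξ.1.1 v u)) := by
    refine forall₂_congr fun u v => ?_
    rw [h1, h1, hL2, hL2, Prod.mk.injEq, map_sub]
    simp only [true_and]
    have key : ∀ a b c d : E, a - b = c - d ↔ b - d = a - c := fun a b c d =>
      ⟨fun h => by rw [sub_eq_iff_eq_add.1 h]; abel, fun h => by rw [sub_eq_iff_eq_add.1 h]; abel⟩
    exact key _ _ _ _
  -- The torsion condition is needed here: it makes Γ'((L u) v, A w) symmetric in u and v, so that
  -- this term cancels. The mixed terms Γ'(A u, A Γ(v, w)) + Γ'(A v, A Γ(u, w)) are symmetric by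
  -- themselves, and the curvatures are left.
  have hR : (∀ u v : E, (L u).2 v = (L v).2 u) → ∀ u v w : E,
      ((𝔰.daffine ξ (L u) v).2 w = (𝔰.daffine ξ (L v) u).2 w ↔
      𝔰.dchristoffel ξ.1.2 (lin ξ u) (lin ξ v) (lin ξ w) -
        𝔰.dchristoffel ξ.1.2 (lin ξ v) (lin ξ u) (lin ξ w) +
        𝔰.christoffel ξ.1.2 ξ.1.2 (lin ξ u) (𝔰.christoffel ξ.1.2 ξ.1.2 (lin ξ v) (lin ξ w)) -
        𝔰.christoffel ξ.1.2 ξ.1.2 (lin ξ v) (𝔰.christoffel ξ.1.2 ξ.1.2 (lin ξ u) (lin ξ w)) =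
      lin ξ (𝔰.dchristoffel ξ.1.1 u v w - 𝔰.dchristoffel ξ.1.1 v u w +
        𝔰.christoffel ξ.1.1 ξ.1.1 u (𝔰.christoffel ξ.1.1 ξ.1.1 v w) -
        𝔰.christoffel ξ.1.1 ξ.1.1 v (𝔰.christoffel ξ.1.1 ξ.1.1 u w))) := by
    intro hs u v w
    rw [h2, h2, hL1, hL1, hs u v]
    simp only [hL2, map_sub, map_add]
    have key : ∀ p q r s : E, p - q = s - r → (p = q ↔ r = s) := fun p q r s h => by
      rw [← sub_eq_zero, h, sub_eq_zero, eq_comm]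
    refine key _ _ _ _ ?_
    abel
  have hsymm : 𝔰.IsSymmAt ξ ↔ (∀ u v : E, (𝔰.daffine ξ (L u) v).1 = (𝔰.daffine ξ (L v) u).1) ∧
      ∀ u v w : E, (𝔰.daffine ξ (L u) v).2 w = (𝔰.daffine ξ (L v) u).2 w := by
    refine ⟨fun h => ⟨fun u v => congrArg Prod.fst (h u v),
      fun u v w => congrArg (fun z : (E × E) × (E →L[ℝ] E) => z.2 w) (h u v)⟩,
      fun h u v => Prod.ext (h.1 u v) (ContinuousLinearMap.ext fun w => h.2 u v w)⟩
  rw [hsymm, hT]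
  refine and_congr_right fun h => ?_
  have hs : ∀ u v : E, (L u).2 v = (L v).2 u := fun u v => by
    have := hT.2 h u v
    rw [h1, h1] at this
    exact congrArg Prod.snd this
  exact forall₃_congr (hR hs)

/-- The element `⟨⟨Y, (X, W)⟩, ((Z, Y'), (X', W'))⟩` of the third tangent bundle. -/
def mk3 (x : M) (Y X W Z Y' X' W' : E) : T3At (E := E) x :=
  ⟨⟨Y, (X, W)⟩, ((Z, Y'), (X', W'))⟩

/-- In the trivialization at `ξ` the map `S` has the identity as base component and `affineCoord` as
fibre component. -/
lemma S3_apply (ξ : Jet1 E M) (v : E) :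
    𝔰.S3 ξ v = ((𝔰.affineJet ξ v, 𝔰.daffine ξ (𝔰.affineJet ξ v)) :
      ((E × E) × (E →L[ℝ] E)) × (E →L[ℝ] (E × E) × (E →L[ℝ] E))) := by
  have hC := (𝔰.hasChartDeriv_affineCoord ξ).hasMFDerivAt
  have h1 : HasMFDerivAt (IJ1 E) (IJ1 E) (fun η : Jet1 E M => (𝔰.S η).proj) ξ
      (ContinuousLinearMap.id ℝ (TangentSpace (IJ1 E) ξ)) := hasMFDerivAt_id ξ
  have hS : MDifferentiableAt (IJ1 E) (IJ2 E) 𝔰.S ξ :=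
    (mdifferentiableAt_totalSpace (IJ1 E) 𝔰.S).2 ⟨h1.mdifferentiableAt, hC.mdifferentiableAt⟩
  have h2 := hasMFDerivAt_totalSpace (IN := IJ1 E) (IB := IJ1 E) (f := 𝔰.S) (x := ξ)
    hS.continuousAt h1 hC
  rw [S3, h2.mfderiv]
  rfl

lemma isKappaInvariant_iff (ξ : Jet1 E M) :
    IsKappaInvariant (𝔰.S3 ξ) ↔ 𝔰.IsSymmAt ξ := by
  let L : E → (E × E) × (E →L[ℝ] E) := fun u => 𝔰.affineJet ξ u
  have hact : ∀ Y X W Z Y' X' W' : E, act111 (𝔰.S3 ξ) (mk3 ξ.1.1 Y X W Z Y' X' W') =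
      mk3 ξ.1.2 (lin ξ Y) (L X).1.2 (lin ξ W + (L X).2 Y) (L Z).1.2 (lin ξ Y' + (L Z).2 Y)
        ((L X').1.2 + (𝔰.daffine ξ (L Z) X).1.2)
        (lin ξ W' + (L Z).2 W + (L X').2 Y + (𝔰.daffine ξ (L Z) X).2 Y + (L X).2 Y') := by
    intro Y X W Z Y' X' W'
    have h : act111 (𝔰.S3 ξ) (mk3 ξ.1.1 Y X W Z Y' X' W') =
      (fun Λ : ((E × E) × (E →L[ℝ] E)) × (E →L[ℝ] (E × E) × (E →L[ℝ] E)) =>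
        mk3 ξ.1.2 (lin ξ Y) (L X).1.2 (lin ξ W + (L X).2 Y) Λ.1.1.2 (lin ξ Y' + Λ.1.2 Y)
        ((L X').1.2 + (Λ.2 X).1.2)
        (lin ξ W' + Λ.1.2 W + (L X').2 Y + (Λ.2 X).2 Y + (L X).2 Y')) (𝔰.S3 ξ Z) := rfl
    rw [h, S3_apply]
  have hk : ∀ Y X W Z Y' X' W' : E, kappa (mk3 (M := M) ξ.1.1 Y X W Z Y' X' W') =
    mk3 ξ.1.1 Y Z Y' X W X' W' := fun _ _ _ _ _ _ _ => rfl
  have hk' : ∀ Y X W Z Y' X' W' : E, kappa (mk3 (M := M) ξ.1.2 Y X W Z Y' X' W') =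
    mk3 ξ.1.2 Y Z Y' X W X' W' := fun _ _ _ _ _ _ _ => rfl
  constructor
  · intro h u v
    -- With W, Y', X', W' all zero, only the second derivative survives in the last two components;
    -- the free foot `w` tests its endomorphism part.
    have h1 : ∀ w : E, _ := fun w => ((congrArg kappa (hact w u 0 v 0 0 0)).symm.trans
      (h (mk3 ξ.1.1 w v 0 u 0 0 0))).trans (hact w v 0 u 0 0 0)
    have h2 := fun w => congrArg (fun q : T3At (E := E) ξ.1.2 => (q.2.2.1 : E)) (h1 w)
    have h3 := fun w => congrArg (fun q : T3At (E := E) ξ.1.2 => (q.2.2.2 : E)) (h1 w)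
    simp only [mk3, kappa, map_zero, zero_add, add_zero, add_right_inj] at h2 h3
    have h4 := (𝔰.daffine_apply ξ (L u) v).1
    have h5 := (𝔰.daffine_apply ξ (L v) u).1
    refine (Prod.ext (Prod.ext ?_ (h2 0)) (ContinuousLinearMap.ext h3)).symm
    exact (congrArg Prod.fst h5).trans (congrArg Prod.fst h4).symm
  · rintro h ⟨⟨Y, X, W⟩, ⟨⟨Z, Y'⟩, X', W'⟩⟩
    refine ((congrArg kappa (hact Y Z Y' X W X' W')).trans ?_).trans (hact Y X W Z Y' X' W').symm
    have h1 : 𝔰.daffine ξ (L X) Z = 𝔰.daffine ξ (L Z) X := h X Z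
    -- κ exchanges the two mixed terms (L X) Y' and (L Z) W and fixes the others, once `h1` is used.
    have key : ∀ a b c d e : E, a + b + c + d + e = a + e + c + d + b := by
      intros
      abel
    rw [h1, key]
    rfl

end SymmetryJet

end Kappa

/-! ### Brackets of fields tangent to the affine distribution. -/

section Integrability

variable {E : Type*} [NormedAddCommGroup E] [NormedSpace ℝ E]
  {M : Type*} [TopologicalSpace M] [ChartedSpace E M] [IsManifold 𝓘(ℝ, E) ∞ M]

/-- The coordinates of a tangent vector at `η`, in the charts at the source and the target of `ξ`. -/
def velocityCoord (ξ η : Jet1 E M) (U : TangentSpace (IJ1 E) η) : (E × E) × (E →L[ℝ] E) :=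
  (trivializationAt ((E × E) × (E →L[ℝ] E)) (TangentSpace (IJ1 E) : Jet1 E M → Type _) ξ ⟨η, U⟩).2

namespace SymmetryJet
set_option synthInstance.maxHeartbeats 400000
variable (𝔰 : SymmetryJet E M)

lemma affineCoord_apply {ξ η : Jet1 E M} (hx : η.1.1 ∈ (chartAt E ξ.1.1).source)
    (hy : η.1.2 ∈ (chartAt E ξ.1.2).source) (v : E) :
    𝔰.affineCoord ξ η v =
      velocityCoord ξ η (𝔰.affineJet η (trans ξ.1.1 η.1.1 η.1.1 v : E)) :=
  jetCoord₂_apply (j := 𝔰.S η) hx hy v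

lemma affineCoord_apply_fst {ξ η : Jet1 E M} (hx : η.1.1 ∈ (chartAt E ξ.1.1).source)
    (hy : η.1.2 ∈ (chartAt E ξ.1.2).source) (v : E) : (𝔰.affineCoord ξ η v).1.1 = v :=
  congrArg (fun z : (E × E) × (E →L[ℝ] E) => z.1.1) (𝔰.jetCoord₂_S hx hy v)

/-- The coordinates of a vector tangent to the affine distribution. -/
lemma velocityCoord_of_mem {ξ η : Jet1 E M} (hx : η.1.1 ∈ (chartAt E ξ.1.1).source)
    (hy : η.1.2 ∈ (chartAt E ξ.1.2).source) {U : TangentSpace (IJ1 E) η}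
    (hU : U ∈ 𝔰.distribution η) :
    velocityCoord ξ η U = 𝔰.affineCoord ξ η (velocityCoord ξ η U).1.1 := by
  obtain ⟨v, rfl⟩ := hU
  have h1 := 𝔰.affineCoord_apply hx hy (trans η.1.1 ξ.1.1 η.1.1 v)
  have h2 : velocityCoord ξ η (𝔰.affineJet η v) = _ := (congrArg (fun w : E =>
    velocityCoord ξ η (𝔰.affineJet η w)) (trans_trans_cancel (mem_chart_source E _) hx v)).symm.trans
    h1.symm
  refine h2.trans (congrArg (𝔰.affineCoord ξ η) ?_)
  exact ((congrArg (fun z : (E × E) × (E →L[ℝ] E) => z.1.1) h2).trans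
    (𝔰.affineCoord_apply_fst hx hy _)).symm

lemma velocityCoord_self (ξ : Jet1 E M) (U : TangentSpace (IJ1 E) ξ) : velocityCoord ξ ξ U = U :=
  (tangentBundleCore (IJ1 E) (Jet1 E M)).coordChange_self (achart _ ξ) ξ (mem_chart_source _ ξ) _

/-- The first derivative of a vector field that is tangent to the affine distribution. -/
lemma exists_hasChartDeriv_of_mem {ξ : Jet1 E M} {A : ∀ η : Jet1 E M, TangentSpace (IJ1 E) η}
    (hA : ContMDiffAt (IJ1 E) (IJ1 E).tangent ∞
      (fun η => (⟨η, A η⟩ : TangentBundle (IJ1 E) (Jet1 E M))) ξ)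
    (hD : ∀ᶠ η in 𝓝 ξ, A η ∈ 𝔰.distribution η) :
    ∃ (a : E) (c : (E × E) × (E →L[ℝ] E) →L[ℝ] E), A ξ = 𝔰.affineJet ξ a ∧
      HasChartDeriv (IJ1 E) (fun η => velocityCoord ξ η (A η)) ξ
        ((𝔰.affineCoord ξ ξ).comp c + (𝔰.daffine ξ).flip a) := by
  have hx := mem_chart_source E ξ.1.1
  have hy := mem_chart_source E ξ.1.2
  have h1 := ((contMDiffAt_section (IB := IJ1 E) (F := (E × E) × (E →L[ℝ] E)) (n := ∞)
    (E := (TangentSpace (IJ1 E) : Jet1 E M → Type _)) (s := A) ξ).1 hA).mdifferentiableAt (by simp)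
  obtain ⟨C, hC⟩ := HasChartDeriv.of_mdifferentiableAt h1
  have ha := HasChartDeriv.comp hasFDerivAt_fst (HasChartDeriv.comp hasFDerivAt_fst hC)
  have h2 : velocityCoord ξ ξ (A ξ) = A ξ := velocityCoord_self ξ (A ξ)
  have h3 : (velocityCoord ξ ξ (A ξ)).1.1 = (A ξ).1.1 := by rw [h2]
  -- Near `ξ` the field is F(η) applied to its own source component, which is differentiable; the
  -- product rule applies.
  have h4 := ((𝔰.hasChartDeriv_affineCoord ξ).clm_apply ha).congr
    (g := fun η => velocityCoord ξ η (A η)) (by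
      filter_upwards [hD, eventually_mem_source hx hy] with η h5 h6
      exact (𝔰.velocityCoord_of_mem h6.1 h6.2 h5).symm)
  refine ⟨(velocityCoord ξ ξ (A ξ)).1.1, _, ?_, h4⟩
  have h7 := 𝔰.velocityCoord_of_mem hx hy hD.self_of_nhds
  rw [affineCoord_self_apply] at h7
  exact h2.symm.trans h7

/-- The bracket of two vector fields that are tangent to the affine distribution. -/
lemma mlieBracket_eq {ξ : Jet1 E M} {A B : ∀ η : Jet1 E M, TangentSpace (IJ1 E) η} {a b : E}
    {c d : (E × E) × (E →L[ℝ] E) →L[ℝ] E} (ha : A ξ = 𝔰.affineJet ξ a)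
    (hb : B ξ = 𝔰.affineJet ξ b)
    (hA : HasChartDeriv (IJ1 E) (fun η => velocityCoord ξ η (A η)) ξ
        ((𝔰.affineCoord ξ ξ).comp c + (𝔰.daffine ξ).flip a))
    (hB : HasChartDeriv (IJ1 E) (fun η => velocityCoord ξ η (B η)) ξ
        ((𝔰.affineCoord ξ ξ).comp d + (𝔰.daffine ξ).flip b)) :
    VectorField.mlieBracket (IJ1 E) A B ξ = (𝔰.affineCoord ξ ξ (d (A ξ) - c (B ξ)) +
      (𝔰.daffine ξ (𝔰.affineJet ξ a) b - 𝔰.daffine ξ (𝔰.affineJet ξ b) a) :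
        (E × E) × (E →L[ℝ] E)) := by
  refine (mlieBracket_eq_of_hasChartDeriv hA hB).trans ?_
  rw [← ha, ← hb, map_sub]
  change 𝔰.affineCoord ξ ξ (d (A ξ)) + 𝔰.daffine ξ (A ξ) b -
    (𝔰.affineCoord ξ ξ (c (B ξ)) + 𝔰.daffine ξ (B ξ) a) = _
  abel

/-- The distribution is a graph over the source directions, so it meets the vectors without source
component only in 0. -/
lemma mem_distribution_add_iff (ξ : Jet1 E M) (e : E) {U : (E × E) × (E →L[ℝ] E)}
    (hU : U.1.1 = 0) :
    (𝔰.affineCoord ξ ξ e + U : (E × E) × (E →L[ℝ] E)) ∈ 𝔰.distribution ξ ↔ U = 0 := by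
  have h1 := 𝔰.affineCoord_apply_fst (mem_chart_source E ξ.1.1) (mem_chart_source E ξ.1.2)
  constructor
  · rintro ⟨w, hw⟩
    have hw' : 𝔰.affineCoord ξ ξ w = 𝔰.affineCoord ξ ξ e + U :=
      (𝔰.affineCoord_self_apply ξ w).trans hw
    have h2 : w = e := by
      rw [← h1 w, hw', Prod.fst_add, Prod.fst_add, h1, hU, add_zero]
    rw [h2] at hw'
    exact left_eq_add.1 hw'
  · rintro rfl
    exact ⟨e, ((add_zero _).trans (𝔰.affineCoord_self_apply ξ e)).symm⟩

/-- The derivatives `c`, `d` of the coefficients contribute only vectors of the distribution, so the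
condition depends on the values at `ξ` alone. -/
lemma mlieBracket_mem_iff {ξ : Jet1 E M} {A B : ∀ η : Jet1 E M, TangentSpace (IJ1 E) η} {a b : E}
    {c d : (E × E) × (E →L[ℝ] E) →L[ℝ] E} (ha : A ξ = 𝔰.affineJet ξ a)
    (hb : B ξ = 𝔰.affineJet ξ b)
    (hA : HasChartDeriv (IJ1 E) (fun η => velocityCoord ξ η (A η)) ξ
        ((𝔰.affineCoord ξ ξ).comp c + (𝔰.daffine ξ).flip a))
    (hB : HasChartDeriv (IJ1 E) (fun η => velocityCoord ξ η (B η)) ξ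
        ((𝔰.affineCoord ξ ξ).comp d + (𝔰.daffine ξ).flip b)) :
    VectorField.mlieBracket (IJ1 E) A B ξ ∈ 𝔰.distribution ξ ↔
      𝔰.daffine ξ (𝔰.affineJet ξ a) b = 𝔰.daffine ξ (𝔰.affineJet ξ b) a := by
  rw [𝔰.mlieBracket_eq ha hb hA hB]
  refine (𝔰.mem_distribution_add_iff ξ _ ?_).trans sub_eq_zero
  have h0 : ∀ U v, (𝔰.daffine ξ U v).1.1 = 0 := fun U v =>
    congrArg Prod.fst (𝔰.daffine_apply ξ U v).1
  exact (congrArg₂ (fun p q : E => p - q) (h0 _ _) (h0 _ _)).trans (sub_self _)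

variable [CompleteSpace E]

/-- Any vector tangent to the affine distribution at `ξ` extends to a field tangent to the
distribution. -/
lemma exists_extension {ξ : Jet1 E M} (hξ : ξ ∈ invertibleJets E M) :
    ∃ V : Set (Jet1 E M), IsOpen V ∧ ξ ∈ V ∧ V ⊆ invertibleJets E M ∧
      ∀ u : E, ∃ A : ∀ η : Jet1 E M, TangentSpace (IJ1 E) η,
        ContMDiffOn (IJ1 E) (IJ1 E).tangent ∞
          (fun η => (⟨η, A η⟩ : TangentBundle (IJ1 E) (Jet1 E M))) V ∧
        (∀ η ∈ V, A η ∈ 𝔰.distribution η) ∧ A ξ = 𝔰.affineJet ξ u := by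
  have hx := mem_chart_source E ξ.1.1
  have hy := mem_chart_source E ξ.1.2
  obtain ⟨V, hV, hVo, hξV⟩ := mem_nhds_iff.1 (Filter.inter_mem
    ((isOpen_jet_source ξ.1).mem_nhds ⟨hx, hy⟩) (invertibleJets_mem_nhds hξ))
  -- The field has constant coefficient `u` in the chart at the source of `ξ`. The set `V` does not
  -- depend on `u`, so two such fields can be bracketed on it.
  refine ⟨V, hVo, hξV, fun η h => (hV h).2, fun u =>
    ⟨fun η => 𝔰.affineJet η (trans ξ.1.1 η.1.1 η.1.1 u : E), ?_, fun η _ => ⟨_, rfl⟩, ?_⟩⟩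
  · let e := trivializationAt ((E × E) × (E →L[ℝ] E))
      (TangentSpace (IJ1 E) : Jet1 E M → Type _) ξ
    have hs : V ⊆ e.baseSet := fun η h => mem_chart_source_jet (hV h).1.1 (hV h).1.2
    refine (e.contMDiffOn_section_iff (IB := IJ1 E) (n := ∞) hVo hs).2 ?_
    have h := ((𝔰.contMDiffOn_affineCoord ξ).mono fun η h => (hV h).1).clm_apply
      (contMDiffOn_const (c := u))
    exact h.congr fun η h => (𝔰.affineCoord_apply (hV h).1.1 (hV h).1.2 u).symm
  · change 𝔰.affineJet ξ (trans ξ.1.1 ξ.1.1 ξ.1.1 u : E) = _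
    rw [trans_self hx]
    rfl

theorem mem_integrabilityLocus_iff {ξ : Jet1 E M} (hξ : ξ ∈ invertibleJets E M) :
    ξ ∈ integrabilityLocus (IJ1 E) (invertibleJets E M) 𝔰.distribution ↔ 𝔰.IsSymmAt ξ := by
  constructor
  · rintro ⟨-, h⟩ u v
    obtain ⟨V, hV, hξV, hVs, hext⟩ := 𝔰.exists_extension hξ
    obtain ⟨A, hA, hAD, hAu⟩ := hext u
    obtain ⟨B, hB, hBD, hBv⟩ := hext v
    have hn := hV.mem_nhds hξV
    obtain ⟨a, c, ha, hA'⟩ := 𝔰.exists_hasChartDeriv_of_mem (hA.contMDiffAt hn)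
      (Filter.eventually_of_mem hn hAD)
    obtain ⟨b, d, hb, hB'⟩ := 𝔰.exists_hasChartDeriv_of_mem (hB.contMDiffAt hn)
      (Filter.eventually_of_mem hn hBD)
    have h1 := (𝔰.mlieBracket_mem_iff ha hb hA' hB').1 (h V hV hξV hVs A B hA hB hAD hBD)
    -- The coefficients `a`, `b` come from an existence statement; the source component identifies
    -- them with the prescribed `u`, `v`.
    have inj : ∀ {p q : E}, 𝔰.affineJet ξ p = 𝔰.affineJet ξ q → p = q := fun {p q} h => by
      have := congrArg (fun z : (E × E) × (E →L[ℝ] E) => z.1.1) h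
      exact (congrArg Prod.fst (𝔰.affineJet_fst ξ p)).symm.trans
        (this.trans (congrArg Prod.fst (𝔰.affineJet_fst ξ q)))
    obtain rfl := inj (ha.symm.trans hAu)
    obtain rfl := inj (hb.symm.trans hBv)
    exact h1
  · refine fun h => ⟨hξ, fun V hV hξV _ A B hA hB hAD hBD => ?_⟩
    have hn := hV.mem_nhds hξV
    obtain ⟨a, c, ha, hA'⟩ := 𝔰.exists_hasChartDeriv_of_mem (hA.contMDiffAt hn)
      (Filter.eventually_of_mem hn hAD)
    obtain ⟨b, d, hb, hB'⟩ := 𝔰.exists_hasChartDeriv_of_mem (hB.contMDiffAt hn)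
      (Filter.eventually_of_mem hn hBD)
    exact (𝔰.mlieBracket_mem_iff ha hb hA' hB').2 (h a b)

end SymmetryJet

end Integrability

/-! ### Jets preserving torsion and curvature, and the subgroupoid property. -/

section Groupoid

variable {E : Type*} [NormedAddCommGroup E] [NormedSpace ℝ E]
  {M : Type*} [TopologicalSpace M] [ChartedSpace E M] [IsManifold 𝓘(ℝ, E) ∞ M]

variable [FiniteDimensional ℝ E] (𝔰 : SymmetryJet E M)

lemma mem_preserving_iff {ξ : Jet1 E M} (hξ : ξ ∈ invertibleJets E M) :
    ξ ∈ preserving 𝔰 ↔ 𝔰.IsSymmAt ξ := by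
  have : CompleteSpace E := FiniteDimensional.complete ℝ E
  have : IsManifold 𝓘(ℝ, E) 2 M := IsManifold.of_le (n := ∞) (by norm_cast)
  rw [SymmetryJet.isSymmAt_iff]
  refine (and_iff_right hξ).trans (and_congr (forall₂_congr fun u v => ?_)
    (forall₃_congr fun u v w => ?_))
  · have h1 := 𝔰.torsion_eq ξ.1.2 (lin ξ u) (lin ξ v)
    have h2 := congrArg (fun z : E => lin ξ z) (𝔰.torsion_eq ξ.1.1 u v)
    exact ⟨fun h => h1.symm.trans (h.trans h2), fun h => h1.trans (h.trans h2.symm)⟩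
  · have h1 := 𝔰.curvature_eq ξ.1.2 (lin ξ u) (lin ξ v) (lin ξ w)
    have h2 := congrArg (fun z : E => lin ξ z) (𝔰.curvature_eq ξ.1.1 u v w)
    exact ⟨fun h => h1.symm.trans (h.trans h2), fun h => h1.trans (h.trans h2.symm)⟩

theorem integrabilityLocus_eq_preserving :
    integrabilityLocus (IJ1 E) (invertibleJets E M) 𝔰.distribution = preserving 𝔰 := by
  have : CompleteSpace E := FiniteDimensional.complete ℝ E
  ext ξ
  constructor
  · exact fun h => (mem_preserving_iff 𝔰 h.1).2 ((𝔰.mem_integrabilityLocus_iff h.1).1 h)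
  · exact fun h => (𝔰.mem_integrabilityLocus_iff h.1).2 ((mem_preserving_iff 𝔰 h.1).1 h)

theorem isSubgroupoid_preserving : IsSubgroupoid (preserving 𝔰) where
  subset _ h := h.1
  one_mem x := ⟨ContinuousLinearMap.isInvertible_equiv (f := ContinuousLinearEquiv.refl ℝ _),
    fun _ _ => rfl, fun _ _ _ => rfl⟩
  comp_mem x y z A B hA hB := ⟨ContinuousLinearMap.IsInvertible.comp hB.1 hA.1,
    fun u v => (hB.2.1 (A u) (A v)).trans (congrArg B (hA.2.1 u v)),
    fun u v w => (hB.2.2 (A u) (A v) (A w)).trans (congrArg B (hA.2.2 u v w))⟩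
  inv_mem x y A h := by
    have : CompleteSpace E := FiniteDimensional.complete ℝ E
    have : IsManifold 𝓘(ℝ, E) 2 M := IsManifold.of_le (n := ∞) (by norm_cast)
    -- Preservation by the inverse is preservation by `A` evaluated on the vectors `A.symm u`.
    have hA : ∀ u, A (A.symm u) = u := A.apply_symm_apply
    refine ⟨ContinuousLinearMap.isInvertible_equiv (f := A.symm), fun u v => ?_, fun u v w => ?_⟩
    · have h1 : 𝔰.nabla.torsion y (A (A.symm u)) (A (A.symm v)) =
        A (𝔰.nabla.torsion x (A.symm u) (A.symm v)) := h.2.1 (A.symm u) (A.symm v)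
      rw [hA, hA] at h1
      exact (A.symm_apply_eq.2 h1).symm
    · have h1 : curvature 𝔰.nabla y (A (A.symm u)) (A (A.symm v)) (A (A.symm w)) =
        A (curvature 𝔰.nabla x (A.symm u) (A.symm v) (A.symm w)) :=
          h.2.2 (A.symm u) (A.symm v) (A.symm w)
      rw [hA, hA, hA] at h1
      exact (A.symm_apply_eq.2 h1).symm

end Groupoid

end JetGpd
end

theorem lemma7p8 {E : Type*} [NormedAddCommGroup E] [NormedSpace ℝ E] [FiniteDimensional ℝ E]
    {M : Type*} [TopologicalSpace M] [ChartedSpace E M] [IsManifold 𝓘(ℝ, E) ∞ M]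
    (𝔰 : JetGpd.SymmetryJet E M) :
    (∀ ξ ∈ JetGpd.invertibleJets E M,
      (ξ ∈ JetGpd.integrabilityLocus (JetGpd.IJ1 E) (JetGpd.invertibleJets E M) 𝔰.distribution ↔
        JetGpd.SymmetryJet.IsKappaInvariant (𝔰.S3 ξ))) ∧
    JetGpd.integrabilityLocus (JetGpd.IJ1 E) (JetGpd.invertibleJets E M) 𝔰.distribution =
      JetGpd.preserving 𝔰 ∧
    JetGpd.IsSubgroupoid
      (JetGpd.integrabilityLocus (JetGpd.IJ1 E) (JetGpd.invertibleJets E M) 𝔰.distribution) := by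
  have : CompleteSpace E := FiniteDimensional.complete ℝ E
  refine ⟨fun ξ hξ => (𝔰.mem_integrabilityLocus_iff hξ).trans (𝔰.isKappaInvariant_iff ξ).symm,
    JetGpd.integrabilityLocus_eq_preserving 𝔰, ?_⟩
  rw [JetGpd.integrabilityLocus_eq_preserving 𝔰]
  exact JetGpd.isSubgroupoid_preserving 𝔰
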